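/- Let $n\ge 1$ and let $V:\mathbb R^n\to\mathbb R^n$ be a smooth, $\mathbb Z^n$-periodic vector field with $\operatorname{div}V=0$ and $\int_{[0,1]^n}V\,dx=0$, and assume that $V$ is not identically zero. For $\varepsilon>0$ and $p\in\mathbb R^n$ let $\overline H_\varepsilon(p)$ denote the effective Hamiltonian of the flow velocity $\varepsilon V$, i.e. the unique constant $c\in\mathbb R$ such that the cell problem $$|p+Du|^2+\varepsilon V(x)\cdot(p+Du)=c\quad\text{in }\mathbb R^n$$ has a Lipschitz continuous $\mathbb Z^n$-periodic viscosity solution $u$, and let $$\alpha_\varepsilon(p)=\inf_{\lambda>0}\frac{1+\overline H_\varepsilon(\lambda p)}{\lambda}$$ be the effective burning velocity associated with $\varepsilon V$. Then there exists $\varepsilon_0>0$ such that for every $\varepsilon\in(0,\varepsilon_0)$: the constant $\overline H_\varepsilon(p)$ exists and is unique for all $p\in\mathbb R^n$; the level set $S_\varepsilon=\{p\in\mathbb R^n:\alpha_\varepsilon(p)=1\}$ is not round, i.e. it is not a Euclidean sphere $\{p:|p-z|=r\}$ for any centre $z\in\mathbb R^n$ and radius $r$; and the function $\alpha_\varepsilon$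 is not Euclidean, i.e. there is no constant $b\in\mathbb R$ with $\alpha_\varepsilon(p)=b|p|$ for all $p\in\mathbb R^n$. -/

import Mathlib

open scoped ContDiff

noncomputable section

/-- `f` is periodic with respect to the lattice of integer vectors. -/
def IsLatticePeriodic {n : ℕ} {F : Type*} (f : EuclideanSpace ℝ (Fin n) → F) : Prop :=
  ∀ (k : Fin n → ℤ) (x : EuclideanSpace ℝ (Fin n)),
    f (x + WithLp.toLp 2 (fun i => (k i : ℝ))) = f x

/-- The divergence `∑ i, ∂ᵢ Vᵢ` of a vector field. -/
def vectorDivergence {n : ℕ} (V : EuclideanSpace ℝ (Fin n) → EuclideanSpace ℝ (Fin n))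
    (x : EuclideanSpace ℝ (Fin n)) : ℝ :=
  ∑ i : Fin n, (fderiv ℝ V x (EuclideanSpace.single i (1 : ℝ))) i

/-- The closed unit cube, a fundamental domain (up to null sets) of the flat torus. -/
def unitCube (n : ℕ) : Set (EuclideanSpace ℝ (Fin n)) :=
  {x | ∀ i, x i ∈ Set.Icc (0 : ℝ) 1}

/-- The Hamiltonian `H(q, x) = |q|² + V(x) · q`. -/
def flowHamiltonian {n : ℕ} (V : EuclideanSpace ℝ (Fin n) → EuclideanSpace ℝ (Fin n))
    (q x : EuclideanSpace ℝ (Fin n)) : ℝ :=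
  ‖q‖ ^ 2 + inner ℝ (V x) q

/-- Viscosity subsolutions of `H(p + Du, x) = c` on the whole space. -/
def IsCellSubsolution {n : ℕ} (V : EuclideanSpace ℝ (Fin n) → EuclideanSpace ℝ (Fin n))
    (p : EuclideanSpace ℝ (Fin n)) (c : ℝ) (u : EuclideanSpace ℝ (Fin n) → ℝ) : Prop :=
  ∀ (φ : EuclideanSpace ℝ (Fin n) → ℝ) (x : EuclideanSpace ℝ (Fin n)),
    ContDiff ℝ 1 φ → IsLocalMax (fun y => u y - φ y) x →
      flowHamiltonian V (p + gradient φ x) x ≤ c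

/-- Viscosity supersolutions of `H(p + Du, x) = c` on the whole space. -/
def IsCellSupersolution {n : ℕ} (V : EuclideanSpace ℝ (Fin n) → EuclideanSpace ℝ (Fin n))
    (p : EuclideanSpace ℝ (Fin n)) (c : ℝ) (u : EuclideanSpace ℝ (Fin n) → ℝ) : Prop :=
  ∀ (φ : EuclideanSpace ℝ (Fin n) → ℝ) (x : EuclideanSpace ℝ (Fin n)),
    ContDiff ℝ 1 φ → IsLocalMin (fun y => u y - φ y) x →
      c ≤ flowHamiltonian V (p + gradient φ x) x

/-- The cell problem `|p + Du|² + V(x) · (p + Du) = c` on the torus has a Lipschitz viscosity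
solution; functions on the torus are periodic functions on the whole space. -/
def IsErgodicConstant {n : ℕ} (V : EuclideanSpace ℝ (Fin n) → EuclideanSpace ℝ (Fin n))
    (p : EuclideanSpace ℝ (Fin n)) (c : ℝ) : Prop :=
  ∃ u : EuclideanSpace ℝ (Fin n) → ℝ,
    IsLatticePeriodic u ∧ (∃ K, LipschitzWith K u) ∧
      IsCellSubsolution V p c u ∧ IsCellSupersolution V p c u

/-- The effective Hamiltonian: the constant for which the cell problem at `p` is solvable. -/
def effectiveHamiltonian {n : ℕ} (V : EuclideanSpace ℝ (Fin n) → EuclideanSpace ℝ (Fin n))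
    (p : EuclideanSpace ℝ (Fin n)) : ℝ :=
  Classical.epsilon (IsErgodicConstant V p)

/-- The effective burning velocity
`α(p) = inf_{l > 0} (1 + effectiveHamiltonian V (l p)) / l` of the flow velocity `V`. -/
def burningVelocity {n : ℕ} (V : EuclideanSpace ℝ (Fin n) → EuclideanSpace ℝ (Fin n))
    (p : EuclideanSpace ℝ (Fin n)) : ℝ :=
  ⨅ l : Set.Ioi (0 : ℝ), (1 + effectiveHamiltonian V ((l : ℝ) • p)) / (l : ℝ)

end

/-! To first order in `ε`, the effective Hamiltonian sees only averages of `V · p` along lines in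
direction `p`. A corrector solving `p · Dφ = V · p - average` (`exists_corrector`) removes the
oscillating part of the linear term, and what is left is `|p|² + ε · average + O(ε²)`. For `V = 0`
the burning velocity of a unit vector is `inf (l + 1/l) = 2`.

Two kinds of directions are compared. If `e` is rationally independent, Weyl equidistribution makes
the long line averages uniformly close to the mean, which is zero, so `α(±e) ≤ 2 + εw/4`
(`exists_burningVelocity_le`). If `m` is an integer vector, lines in direction `m` close up on the
torus, and a solution of the cell problem can be tested near any single closed line. With `u =
m/|m|`, a positive circulation along one line then gives `α(u) ≥ 2 + εw/2`, and likewise for `-u`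
(`le_ergodicConstant`, `le_burningVelocity_of_lineAvg`).

A closed line with nonzero circulation exists by Fourier analysis (`exists_lineAvg_ne_zero`): if all
circulations vanished, each coefficient of `V` would be parallel to its frequency, while zero
divergence makes it orthogonal. Zero mean then gives positive circulation somewhere, for `m` and for
`-m`.

So `α(±e) < α(±u)`, which excludes a multiple of the norm. For a sphere with arbitrary centre, the
power of the origin makes `α(v) α(-v)` the same for all unit `v`
(`burningVelocity_mul_neg_of_eq_sphere`), and this is why both signs are controlled.

The ergodic constant is obtained by Perron's method and vanishing discount
(`exists_ergodic_solution`), and its uniqueness by doubling variables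
(`le_of_isCellSubsolution_of_isCellSupersolution`). -/

open scoped ContDiff

open Filter Topology Metric Set MeasureTheory

/-! ### Gradient calculus. -/

section Gradient

variable {E : Type*} [NormedAddCommGroup E] [InnerProductSpace ℝ E] [CompleteSpace E]

theorem HasGradientAt.add' {f g : E → ℝ} {a b x : E} (hf : HasGradientAt f a x)
    (hg : HasGradientAt g b x) : HasGradientAt (fun y => f y + g y) (a + b) x := by
  rw [hasGradientAt_iff_hasFDerivAt] at *
  refine (hf.add hg).congr_fderiv ?_
  simp

theorem HasGradientAt.neg' {f : E → ℝ} {a x : E} (hf : HasGradientAt f a x) :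
    HasGradientAt (fun y => -f y) (-a) x := by
  rw [hasGradientAt_iff_hasFDerivAt] at *
  refine hf.neg.congr_fderiv ?_
  simp

theorem HasGradientAt.const_mul' {f : E → ℝ} {a x : E} (c : ℝ) (hf : HasGradientAt f a x) :
    HasGradientAt (fun y => c * f y) (c • a) x := by
  rw [hasGradientAt_iff_hasFDerivAt] at *
  simpa using hf.const_mul c

theorem hasGradientAt_norm_sub_sq (x y : E) :
    HasGradientAt (fun z => ‖z - x‖ ^ 2) ((2 : ℝ) • (y - x)) y := by
  rw [hasGradientAt_iff_hasFDerivAt]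
  have h := ((hasFDerivAt_id y).sub_const x).norm_sq
  refine h.congr_fderiv ?_
  ext z
  simp [two_mul]

theorem ContDiff.hasGradientAt {f : E → ℝ} (hf : ContDiff ℝ 1 f) (x : E) :
    HasGradientAt f (gradient f x) x :=
  ((hf.differentiable one_ne_zero) x).hasGradientAt

theorem ContDiff.continuous_gradient {f : E → ℝ} (hf : ContDiff ℝ 1 f) :
    Continuous (gradient f) :=
  (InnerProductSpace.toDual ℝ E).symm.continuous.comp (hf.continuous_fderiv one_ne_zero)

theorem IsLocalExtr.gradient_eq_zero {f : E → ℝ} {x : E} (h : IsLocalExtr f x) :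
    gradient f x = 0 := by
  simp [gradient, h.fderiv_eq_zero]

end Gradient

/-! ### Test functions touching from above. -/

section Touching

variable {E : Type*} [NormedAddCommGroup E] [ProperSpace E]

/-- If `φ` touches `u` from above at `x` and `w` is close to `u` near `x`, then a quadratic
perturbation of `φ` touches `w` from above at some point near `x`. -/
theorem exists_isLocalMax_sub_of_approx {u φ : E → ℝ} {x : E} (hφ : Continuous φ)
    (hmax : IsLocalMax (fun y => u y - φ y) x) :
    ∃ r ∈ Ioc (0 : ℝ) 1, ∀ η > 0, 2 * η < r ^ 2 → ∀ w : E → ℝ, Continuous w →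
      (∀ y ∈ closedBall x r, w y ≤ u y + η) → u x - η ≤ w x →
      ∃ y, ‖y - x‖ ^ 2 ≤ 2 * η ∧ IsLocalMax (fun z => w z - (φ z + ‖z - x‖ ^ 2)) y := by
  obtain ⟨r₀, hr₀, hball⟩ := Metric.eventually_nhds_iff_ball.1 hmax
  refine ⟨min (r₀ / 2) 1, ⟨by positivity, min_le_right _ _⟩, fun η hη hηr w hw hwu hwx => ?_⟩
  set r := min (r₀ / 2) 1 with hr
  have hrpos : 0 < r := by positivity
  have hcont : Continuous fun z => w z - (φ z + ‖z - x‖ ^ 2) := by fun_prop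
  obtain ⟨y, hy, hymax⟩ := (isCompact_closedBall x r).exists_isMaxOn
    ⟨x, mem_closedBall_self hrpos.le⟩ hcont.continuousOn
  have h1 := isMaxOn_iff.1 hymax x (mem_closedBall_self hrpos.le)
  have h2 : u y - φ y ≤ u x - φ x := by
    apply hball
    rw [mem_closedBall] at hy
    rw [mem_ball]
    have : r ≤ r₀ / 2 := min_le_left _ _
    linarith
  have h3 := hwu y hy
  -- The quadratic penalty is paid for by the two approximation errors `η`; hence `y` is interior to
  -- the ball.
  have h4 : ‖y - x‖ ^ 2 ≤ 2 * η := by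
    have : ‖x - x‖ ^ 2 = 0 := by simp
    linarith
  refine ⟨y, h4, hymax.isLocalMax ?_⟩
  apply closedBall_mem_nhds_of_mem
  rw [mem_ball, dist_eq_norm]
  exact lt_of_pow_lt_pow_left₀ 2 hrpos.le (h4.trans_lt hηr)

variable [InnerProductSpace ℝ E]

/-- Functions that can only be touched from above with slope at most `K` are Lipschitz. -/
theorem sub_le_of_gradient_le {w : E → ℝ} (hw : Continuous w) {B K : ℝ} (hB : ∀ x, |w x| ≤ B)
    (hK : 0 ≤ K)
    (h : ∀ (φ : E → ℝ) (x : E), ContDiff ℝ 1 φ → IsLocalMax (fun y => w y - φ y) x →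
      ‖gradient φ x‖ ≤ K) (x y : E) : w y - w x ≤ K * ‖y - x‖ := by
  refine le_of_forall_gt_imp_ge_of_dense fun c hc => ?_
  obtain ⟨K', hKK', hK'⟩ : ∃ K' > K, K' * ‖y - x‖ < c := by
    have : Tendsto (fun k : ℝ => k * ‖y - x‖) (𝓝[>] K) (𝓝 (K * ‖y - x‖)) :=
      ((continuous_id.mul continuous_const).tendsto K).mono_left nhdsWithin_le_nhds
    obtain ⟨k, hk1, hk2⟩ := ((this.eventually (gt_mem_nhds hc)).and self_mem_nhdsWithin).exists
    exact ⟨k, hk2, hk1⟩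
  have hK'pos : 0 < K' := hK.trans_lt hKK'
  -- A smoothed cone of opening `K' > K` with vertex `x` touches `w` at `z`. Its slope there is at
  -- most `K`, which is possible only near the vertex.
  have key : ∀ η > 0, ∃ z, K' * ‖z - x‖ ≤ K * Real.sqrt (‖z - x‖ ^ 2 + η ^ 2) ∧
      w y - K' * Real.sqrt (‖y - x‖ ^ 2 + η ^ 2) ≤ w z := by
    intro η hη
    set φ : E → ℝ := fun z => K' * Real.sqrt (‖z - x‖ ^ 2 + η ^ 2) with hφ
    have hpos : ∀ z, 0 < ‖z - x‖ ^ 2 + η ^ 2 := fun z => by positivity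
    have hφC : ContDiff ℝ 1 φ := by
      refine contDiff_const.mul (ContDiff.sqrt ?_ fun z => (hpos z).ne')
      exact ((contDiff_id.sub contDiff_const).norm_sq ℝ).add contDiff_const
    have hle : ∀ z, K' * ‖z - x‖ ≤ φ z := fun z => by
      refine mul_le_mul_of_nonneg_left (Real.le_sqrt_of_sq_le ?_) hK'pos.le
      nlinarith
    have hnon : (closedBall x ((2 * B + φ y) / K' + ‖y - x‖)).Nonempty := ⟨y, by
      rw [mem_closedBall, dist_eq_norm]
      have : 0 ≤ B := (abs_nonneg _).trans (hB x)
      have : 0 ≤ φ y := by positivity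
      have : 0 ≤ (2 * B + φ y) / K' := by positivity
      linarith⟩
    obtain ⟨z, -, hz⟩ := (isCompact_closedBall x _).exists_isMaxOn hnon
      (hw.sub hφC.continuous).continuousOn
    have hglob : ∀ t, w t - φ t ≤ w z - φ z := by
      intro t
      by_cases ht : t ∈ closedBall x ((2 * B + φ y) / K' + ‖y - x‖)
      · exact hz ht
      · have hy : y ∈ closedBall x ((2 * B + φ y) / K' + ‖y - x‖) := by
          rw [mem_closedBall, dist_eq_norm]
          have : 0 ≤ B := (abs_nonneg _).trans (hB x)
          have : 0 ≤ φ y := by positivity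
          have : 0 ≤ (2 * B + φ y) / K' := by positivity
          linarith
        refine le_trans ?_ (hz hy)
        rw [mem_closedBall, dist_eq_norm, not_le] at ht
        have h1 : (2 * B + φ y) / K' < ‖t - x‖ := by
          have := norm_nonneg (y - x)
          linarith
        rw [div_lt_iff₀ hK'pos] at h1
        have := hle t
        have := abs_le.1 (hB t)
        have := abs_le.1 (hB y)
        simp only [Pi.sub_apply]
        nlinarith
    refine ⟨z, ?_, ?_⟩
    · have hs : 0 < Real.sqrt (‖z - x‖ ^ 2 + η ^ 2) := Real.sqrt_pos.2 (hpos z)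
      have hg : HasGradientAt φ ((K' / Real.sqrt (‖z - x‖ ^ 2 + η ^ 2)) • (z - x)) z := by
        have h0 := hasGradientAt_norm_sub_sq x z
        rw [hasGradientAt_iff_hasFDerivAt] at h0 ⊢
        have h1 := ((h0.add_const (η ^ 2)).sqrt (hpos z).ne').const_mul K'
        refine h1.congr_fderiv ?_
        ext v
        simp
        field_simp
      have := h φ z hφC (Filter.Eventually.of_forall hglob)
      rw [hg.gradient, norm_smul, Real.norm_eq_abs, abs_of_pos (by positivity),
        div_mul_eq_mul_div, div_le_iff₀ hs] at this
      exact this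
    · have h1 := hglob y
      have h2 : 0 ≤ φ z := by positivity
      simp only [hφ] at h1 h2
      linarith
  -- let `η` tend to zero
  have hcont : Tendsto (fun η : ℝ => w y - K' * Real.sqrt (‖y - x‖ ^ 2 + η ^ 2)) (𝓝[>] 0)
      (𝓝 (w y - K' * ‖y - x‖)) := by
    have : Continuous fun η : ℝ => w y - K' * Real.sqrt (‖y - x‖ ^ 2 + η ^ 2) := by fun_prop
    have h0 := this.tendsto 0
    simp only [ne_eq, OfNat.ofNat_ne_zero, not_false_eq_true, zero_pow, add_zero,
      Real.sqrt_sq (norm_nonneg (y - x))] at h0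
    exact h0.mono_left nhdsWithin_le_nhds
  have hfin : w y - K' * ‖y - x‖ ≤ w x := by
    refine le_of_forall_pos_le_add fun κ hκ => ?_
    obtain ⟨ρ, hρ, hρw⟩ := Metric.continuous_iff.1 hw x κ hκ
    refine le_of_tendsto hcont ?_
    -- For `η < D * ρ` the slope condition forces `‖z - x‖ < ρ`; the `+ 1` covers `K = 0`.
    set D := (K' - K) / (K + 1) with hD
    have hDpos : 0 < D := div_pos (by linarith) (by linarith)
    have : Ioo (0 : ℝ) (D * ρ) ∈ 𝓝[>] (0 : ℝ) := Ioo_mem_nhdsGT (by positivity)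
    filter_upwards [this] with η hη
    obtain ⟨z, hz1, hz2⟩ := key η hη.1
    refine hz2.trans ?_
    have h3 : Real.sqrt (‖z - x‖ ^ 2 + η ^ 2) ≤ ‖z - x‖ + η := by
      refine Real.sqrt_le_iff.2 ⟨by have := hη.1; positivity, ?_⟩
      nlinarith [norm_nonneg (z - x), hη.1]
    have h4 : (K' - K) * ‖z - x‖ ≤ K * η := by nlinarith
    have h5 : ‖z - x‖ < ρ := by
      have h6 : D * (K + 1) = K' - K := by rw [hD]; field_simp
      have h7 : D * (K + 1) * ‖z - x‖ ≤ K * η := by rw [h6]; exact h4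
      by_contra hcon
      push Not at hcon
      have h8 : D * (K + 1) * ρ ≤ D * (K + 1) * ‖z - x‖ := by gcongr
      nlinarith [hη.1, hη.2]
    have := abs_lt.1 (hρw z (by rwa [dist_eq_norm]))
    linarith
  linarith

end Touching

/-! ### Viscosity inequalities and their stability. -/

section Viscosity

variable {E : Type*} [NormedAddCommGroup E] [InnerProductSpace ℝ E] [ProperSpace E]

/-- Viscosity subsolutions of `F(Du, x) = a(x)`. -/
def ViscositySub (F : E → E → ℝ) (a u : E → ℝ) : Prop :=
  ∀ (φ : E → ℝ) (x : E), ContDiff ℝ 1 φ → IsLocalMax (fun y => u y - φ y) x →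
    F (gradient φ x) x ≤ a x

/-- Viscosity supersolutions of `F(Du, x) = a(x)`. -/
def ViscositySuper (F : E → E → ℝ) (a u : E → ℝ) : Prop :=
  ∀ (φ : E → ℝ) (x : E), ContDiff ℝ 1 φ → IsLocalMin (fun y => u y - φ y) x →
    a x ≤ F (gradient φ x) x

/-- The symmetry `u ↦ -u`, which lets the stability of supersolutions follow from that of
subsolutions. -/
theorem viscositySub_neg_iff {F : E → E → ℝ} {a u : E → ℝ} :
    ViscositySub (fun q x => -F (-q) x) (fun x => -a x) (fun x => -u x) ↔
      ViscositySuper F a u := by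
  have hg : ∀ (φ : E → ℝ) (x : E), ContDiff ℝ 1 φ →
      gradient (fun y => -φ y) x = -gradient φ x :=
    fun φ x hφ => (hφ.hasGradientAt x).neg'.gradient
  constructor
  · intro h φ x hφ hmin
    have := h (fun y => -φ y) x hφ.neg (by
      have h' := hmin.neg
      refine h'.congr (Eventually.of_forall fun y => ?_)
      simp only; ring)
    rw [hg φ x hφ] at this
    simpa using this
  · intro h φ x hφ hmax
    have := h (fun y => -φ y) x hφ.neg (by
      have h' := hmax.neg
      refine h'.congr (Eventually.of_forall fun y => ?_)
      simp only; ring)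
    rw [hg φ x hφ] at this
    simpa using this

/-- Stability of the viscosity inequality at a point under half-relaxed limits. -/
theorem viscositySub_le_of_approx {F : E → E → ℝ} (hF : Continuous (Function.uncurry F))
    {ι : Type*} {l : Filter ι} [l.NeBot] {w A : ι → E → ℝ} (hw : ∀ᶠ i in l, Continuous (w i))
    (hsub : ∀ᶠ i in l, ViscositySub F (A i) (w i)) {u φ : E → ℝ} {x : E} {a : ℝ}
    (hφ : ContDiff ℝ 1 φ) (hmax : IsLocalMax (fun y => u y - φ y) x)
    (h1 : ∀ η > 0, ∀ᶠ i in l, ∀ y ∈ closedBall x 1, w i y ≤ u y + η)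
    (h2 : ∀ η > 0, ∀ᶠ i in l, u x - η ≤ w i x)
    (h3 : ∀ κ > 0, ∃ ρ > 0, ∀ᶠ i in l, ∀ y ∈ ball x ρ, A i y ≤ a + κ) :
    F (gradient φ x) x ≤ a := by
  refine le_of_forall_pos_le_add fun κ hκ => ?_
  -- The added quadratic localises the touching points and has zero gradient at `x`, so it
  -- disappears in the limit.
  have hψg : ∀ y, HasGradientAt (fun z => φ z + ‖z - x‖ ^ 2)
      (gradient φ y + (2 : ℝ) • (y - x)) y := fun y =>
    (hφ.hasGradientAt y).add' (hasGradientAt_norm_sub_sq x y)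
  have hψ : ContDiff ℝ 1 fun z => φ z + ‖z - x‖ ^ 2 :=
    hφ.add ((contDiff_id.sub contDiff_const).norm_sq ℝ)
  have hcont : Continuous fun y => F (gradient φ y + (2 : ℝ) • (y - x)) y := by
    have := hφ.continuous_gradient
    exact hF.comp (by fun_prop : Continuous fun y => (gradient φ y + (2 : ℝ) • (y - x), y))
  obtain ⟨ρ₁, hρ₁, hFρ⟩ := Metric.continuous_iff.1 hcont x (κ / 2) (by positivity)
  obtain ⟨ρ₂, hρ₂, hA⟩ := h3 (κ / 2) (by positivity)
  obtain ⟨r, hr, htouch⟩ := exists_isLocalMax_sub_of_approx hφ.continuous hmax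
  set m := min r (min ρ₁ ρ₂) with hm
  have hmpos : 0 < m := lt_min hr.1 (lt_min hρ₁ hρ₂)
  set η := m ^ 2 / 4 with hη
  have hηpos : 0 < η := by positivity
  have hηm : 2 * η < m ^ 2 := by rw [hη]; nlinarith [pow_pos hmpos 2]
  have hmr : m ^ 2 ≤ r ^ 2 := by gcongr; exact min_le_left _ _
  obtain ⟨i, hwi, hsi, h1i, h2i, hAi⟩ :=
    (hw.and (hsub.and ((h1 η hηpos).and ((h2 η hηpos).and hA)))).exists
  obtain ⟨y, hy, hymax⟩ := htouch η hηpos (hηm.trans_le hmr) (w i) hwi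
    (fun y hy => h1i y (closedBall_subset_closedBall hr.2 hy)) h2i
  have hym : ‖y - x‖ < m := lt_of_pow_lt_pow_left₀ 2 hmpos.le (hy.trans_lt hηm)
  have hs := hsi _ y hψ hymax
  rw [(hψg y).gradient] at hs
  have e1 := abs_lt.1 (hFρ y (by
    rw [dist_eq_norm]
    exact hym.trans_le ((min_le_right _ _).trans (min_le_left _ _))))
  have e2 := hAi y (by
    rw [mem_ball, dist_eq_norm]
    exact hym.trans_le ((min_le_right _ _).trans (min_le_right _ _)))
  simp only [sub_self, smul_zero, add_zero] at e1
  linarith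

end Viscosity

/-! ### Perron's method for the discounted equation. -/

section Perron

theorem lipschitzWith_of_sub_le {E : Type*} [SeminormedAddCommGroup E] {f : E → ℝ} {K : ℝ} (hK : 0 ≤ K)
    (h : ∀ x y, f y - f x ≤ K * ‖y - x‖) : LipschitzWith ⟨K, hK⟩ f := by
  refine LipschitzWith.of_le_add_mul _ fun x y => ?_
  have := h y x
  rw [dist_eq_norm]
  change f x ≤ f y + K * ‖x - y‖
  linarith

variable {E : Type*} [NormedAddCommGroup E] [InnerProductSpace ℝ E] [ProperSpace E]

theorem ViscositySub.sub_const {F : E → E → ℝ} {a w : E → ℝ} (h : ViscositySub F a w) (c : ℝ) :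
    ViscositySub F a fun x => w x - c := by
  intro φ x hφ hmax
  refine h φ x hφ ?_
  filter_upwards [hmax] with y hy
  linarith

theorem ViscositySuper.sub_const {F : E → E → ℝ} {a w : E → ℝ} (h : ViscositySuper F a w)
    (c : ℝ) : ViscositySuper F a fun x => w x - c := by
  intro φ x hφ hmin
  refine h φ x hφ ?_
  filter_upwards [hmin] with y hy
  linarith

theorem ViscositySub.comp_add {F : E → E → ℝ} {a w : E → ℝ} (h : ViscositySub F a w) {k : E}
    (hk : ∀ q x, F q (x + k) = F q x) :
    ViscositySub F (fun x => a (x + k)) fun x => w (x + k) := by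
  intro φ x hφ hmax
  have hg : HasGradientAt (fun z => φ (z - k)) (gradient φ x) (x + k) := by
    have h1 : HasGradientAt φ (gradient φ x) (x + k - k) := by
      simpa using hφ.hasGradientAt x
    rw [hasGradientAt_iff_hasFDerivAt] at h1 ⊢
    exact h1.comp (x + k) ((hasFDerivAt_id (x + k)).sub_const k)
  have hm : IsLocalMax (fun z => w z - φ (z - k)) (x + k) := by
    have ht : Tendsto (fun z => z - k) (𝓝 (x + k)) (𝓝 x) := by
      have hc : Continuous fun z : E => z - k := by fun_prop
      simpa using hc.tendsto (x + k)
    filter_upwards [ht.eventually hmax] with z hz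
    simpa using hz
  have := h (fun z => φ (z - k)) (x + k) (hφ.comp (contDiff_id.sub contDiff_const)) hm
  rwa [hg.gradient, hk] at this

/-- The class of subsolutions of `lam * w + F(Dw, x) = 0` used in Perron's method. -/
def perronClass (F : E → E → ℝ) (C K lam : ℝ) : Set (E → ℝ) :=
  {w | (∀ x y, w y - w x ≤ K * ‖y - x‖) ∧ (∀ x, |lam * w x| ≤ C) ∧
    ViscositySub F (fun x => -(lam * w x)) w}

/-- The pointwise supremum of the Perron class. -/
noncomputable def perronSup (F : E → E → ℝ) (C K lam : ℝ) (x : E) : ℝ :=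
  ⨆ w : perronClass F C K lam, w.1 x

variable {F : E → E → ℝ} {C K lam : ℝ}

theorem const_mem_perronClass (hC : ∀ x, |F 0 x| ≤ C) (hK : 0 ≤ K) (hlam : 0 < lam) :
    (fun _ => -C / lam) ∈ perronClass F C K lam := by
  have hl : lam * (-C / lam) = -C := by field_simp
  refine ⟨fun x y => by simpa using by positivity, fun x => ?_, fun φ x hφ hmax => ?_⟩
  · rw [hl, abs_neg, abs_of_nonneg ((abs_nonneg _).trans (hC x))]
  · have h0 : gradient φ x = 0 := by
      refine IsLocalExtr.gradient_eq_zero (Or.inl ?_)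
      filter_upwards [hmax] with y hy
      linarith
    simp only [h0, hl, neg_neg]
    exact (le_abs_self _).trans (hC x)

theorem bddAbove_perronClass (hlam : 0 < lam) (x : E) :
    BddAbove (range fun w : perronClass F C K lam => w.1 x) := by
  refine ⟨C / lam, ?_⟩
  rintro _ ⟨w, rfl⟩
  rw [le_div_iff₀ hlam, mul_comm]
  exact (le_abs_self _).trans (w.2.2.1 x)

theorem le_perronSup (hlam : 0 < lam) {w : E → ℝ} (hw : w ∈ perronClass F C K lam) (x : E) :
    w x ≤ perronSup F C K lam x :=
  le_ciSup (bddAbove_perronClass hlam x) (⟨w, hw⟩ : perronClass F C K lam)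

/-- Members whose values at `x` tend to the supremum lie below it everywhere, so stability applies
at `x`. The Lipschitz bound built into the class makes the supremum continuous without
semicontinuous envelopes and controls the zeroth order term near `x`. -/
theorem perronSup_mem (hF : Continuous (Function.uncurry F)) (hC : ∀ x, |F 0 x| ≤ C)
    (hK : 0 ≤ K) (hlam : 0 < lam) : perronSup F C K lam ∈ perronClass F C K lam := by
  have hne : Nonempty (perronClass F C K lam) := ⟨⟨_, const_mem_perronClass hC hK hlam⟩⟩
  have hlip : ∀ x y, perronSup F C K lam y - perronSup F C K lam x ≤ K * ‖y - x‖ := by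
    intro x y
    rw [sub_le_iff_le_add]
    refine ciSup_le fun w => ?_
    have := w.2.1 x y
    have := le_perronSup hlam w.2 x
    linarith
  refine ⟨hlip, fun x => ?_, ?_⟩
  · rw [abs_le]
    constructor
    · obtain ⟨w⟩ := hne
      have h1 := (abs_le.1 (w.2.2.1 x)).1
      have h2 := le_perronSup hlam w.2 x
      nlinarith
    · have : perronSup F C K lam x ≤ C / lam := by
        refine ciSup_le fun w => ?_
        rw [le_div_iff₀ hlam, mul_comm]
        exact (le_abs_self _).trans (w.2.2.1 x)
      rw [le_div_iff₀ hlam] at this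
      linarith
  · intro φ x hφ hmax
    have hex : ∀ i : ℕ, ∃ w ∈ perronClass F C K lam,
        perronSup F C K lam x - 1 / ((i : ℝ) + 1) < w x := by
      intro i
      obtain ⟨w, hw⟩ := exists_lt_of_lt_ciSup
        (show perronSup F C K lam x - 1 / ((i : ℝ) + 1) < perronSup F C K lam x by
          have : 0 < 1 / ((i : ℝ) + 1) := by positivity
          linarith)
      exact ⟨w.1, w.2, hw⟩
    choose w hw hwx using hex
    have hsmall : ∀ η > 0, ∀ᶠ i in atTop, perronSup F C K lam x - η ≤ w i x := by
      intro η hη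
      filter_upwards [tendsto_one_div_add_atTop_nhds_zero_nat.eventually (gt_mem_nhds hη)]
        with i hi
      linarith [hwx i]
    refine viscositySub_le_of_approx hF (l := atTop) (w := w)
      (A := fun i y => -(lam * w i y))
      (Eventually.of_forall fun i => (lipschitzWith_of_sub_le hK (hw i).1).continuous)
      (Eventually.of_forall fun i => (hw i).2.2) hφ hmax ?_ hsmall ?_
    · intro η hη
      refine Eventually.of_forall fun i y _ => ?_
      have := le_perronSup hlam (hw i) y
      linarith
    · intro κ hκ
      -- Half of `κ` is spent on the Lipschitz variation over the ball, half on the convergence at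
      -- `x`.
      refine ⟨κ / (2 * lam * (K + 1)), by positivity, ?_⟩
      filter_upwards [hsmall (κ / (2 * lam)) (by positivity)] with i hi y hy
      have h1 := (hw i).1 y x
      rw [mem_ball', dist_eq_norm, lt_div_iff₀ (by positivity)] at hy
      have h2 : lam * (K * ‖x - y‖) ≤ κ / 2 := by
        nlinarith [mul_nonneg hlam.le (norm_nonneg (x - y))]
      have h3 : lam * (perronSup F C K lam x - κ / (2 * lam)) =
          lam * perronSup F C K lam x - κ / 2 := by field_simp
      have h4 := mul_le_mul_of_nonneg_left hi hlam.le
      have h5 := mul_le_mul_of_nonneg_left h1 hlam.le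
      rw [h3] at h4
      rw [mul_sub] at h5
      linarith

/-- A period of `F` translates the class into itself, in both directions. -/
theorem perronSup_periodic {k : E} (hk : ∀ q x, F q (x + k) = F q x) (hlam : 0 < lam)
    (hC : ∀ x, |F 0 x| ≤ C) (hK : 0 ≤ K) (x : E) :
    perronSup F C K lam (x + k) = perronSup F C K lam x := by
  have hne : Nonempty (perronClass F C K lam) := ⟨⟨_, const_mem_perronClass hC hK hlam⟩⟩
  have htr : ∀ k : E, (∀ q x, F q (x + k) = F q x) → ∀ w ∈ perronClass F C K lam,
      (fun x => w (x + k)) ∈ perronClass F C K lam := by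
    intro k hk w hw
    exact ⟨fun x y => by simpa using hw.1 (x + k) (y + k), fun x => hw.2.1 _,
      hw.2.2.comp_add hk⟩
  have hk' : ∀ q x, F q (x + -k) = F q x := fun q x => by
    rw [← hk q (x + -k), neg_add_cancel_right]
  refine le_antisymm (ciSup_le fun w => ?_) (ciSup_le fun w => ?_)
  · exact le_perronSup hlam (htr k hk w.1 w.2) x
  · simpa using le_perronSup hlam (htr (-k) hk' w.1 w.2) (x + k)

/-- Perron's method: the supremum of the subsolutions is a supersolution. -/
theorem perronSup_super (hF : Continuous (Function.uncurry F)) (hC : ∀ x, |F 0 x| ≤ C)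
    (hK : 0 ≤ K) (hcoer : ∀ q x, F q x ≤ C → ‖q‖ ≤ K) (hlam : 0 < lam) :
    ViscositySuper F (fun x => -(lam * perronSup F C K lam x)) (perronSup F C K lam) := by
  obtain ⟨hlip, hbd, hsub⟩ := perronSup_mem (F := F) (C := C) (K := K) hF hC hK hlam
  set v := perronSup F C K lam with hv
  have hvc : Continuous v := (lipschitzWith_of_sub_le hK hlip).continuous
  intro φ x hφ hmin
  by_contra hcon
  push Not at hcon
  -- If `lam * v` attained its bound at `x`, then `φ` would have a local maximum there, and `F 0 x <
  -- -C` would follow. The strict inequality leaves room to raise a bump.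
  have hlt : lam * v x < C := by
    refine lt_of_le_of_ne ((le_abs_self _).trans (hbd x)) fun heq => ?_
    have h0 : gradient φ x = 0 := by
      refine IsLocalExtr.gradient_eq_zero (Or.inr ?_)
      filter_upwards [hmin] with y hy
      have := (le_abs_self _).trans (hbd y)
      have : v y ≤ v x := le_of_mul_le_mul_left (this.trans heq.ge) hlam
      linarith
    rw [h0, heq] at hcon
    exact absurd hcon (not_lt.2 (abs_le.1 (hC x)).1)
  -- the bump
  set ψ : E → ℝ := fun z => φ z + -‖z - x‖ ^ 2 with hψdef
  have hψg : ∀ y, HasGradientAt ψ (gradient φ y + -((2 : ℝ) • (y - x))) y := fun y =>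
    (hφ.hasGradientAt y).add' (hasGradientAt_norm_sub_sq x y).neg'
  have hψC : ContDiff ℝ 1 ψ := hφ.add ((contDiff_id.sub contDiff_const).norm_sq ℝ).neg
  have hψx : ψ x = φ x := by simp [hψdef]
  have hGc : Continuous fun y => F (gradient ψ y) y :=
    hF.comp (hψC.continuous_gradient.prodMk continuous_id)
  set d := v x - φ x with hd
  have hlim1 : Tendsto (fun p : E × ℝ => F (gradient ψ p.1) p.1 + lam * (ψ p.1 + d + p.2))
      (𝓝 (x, 0)) (𝓝 (F (gradient ψ x) x + lam * (ψ x + d + 0))) := by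
    have := hψC.continuous
    have h : Continuous fun p : E × ℝ => F (gradient ψ p.1) p.1 + lam * (ψ p.1 + d + p.2) :=
      (hGc.comp continuous_fst).add (by fun_prop)
    exact h.tendsto (x, 0)
  have hlim2 : Tendsto (fun p : E × ℝ => lam * (ψ p.1 + d + p.2))
      (𝓝 (x, 0)) (𝓝 (lam * (ψ x + d + 0))) := by
    have := hψC.continuous
    have h : Continuous fun p : E × ℝ => lam * (ψ p.1 + d + p.2) := by fun_prop
    exact h.tendsto (x, 0)
  have hval : ψ x + d + 0 = v x := by rw [hψx, hd]; ring
  have hgx : gradient ψ x = gradient φ x := by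
    rw [(hψg x).gradient]; simp
  rw [hval] at hlim1 hlim2
  have e1 := hlim1.eventually (gt_mem_nhds (show F (gradient ψ x) x + lam * v x < 0 by
    rw [hgx]; linarith))
  have e2 := hlim2.eventually (gt_mem_nhds hlt)
  obtain ⟨ρ, hρ, hgood⟩ := Metric.eventually_nhds_iff_ball.1 (e1.and e2)
  obtain ⟨ρ', hρ', hmin'⟩ := Metric.eventually_nhds_iff_ball.1 hmin
  set r := min ρ ρ' with hr
  have hrpos : 0 < r := lt_min hρ hρ'
  -- Since `r ^ 2 / 8 < (r / 2) ^ 2`, the raised bump is below `v` outside the half ball, so the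
  -- glued function is continuous.
  set δ := min (r / 2) (r ^ 2 / 8) with hδ
  have hδpos : 0 < δ := by positivity
  have hδ1 : δ < r := (min_le_left _ _).trans_lt (by linarith)
  have hδ2 : δ ≤ r ^ 2 / 8 := min_le_right _ _
  have hin : ∀ y ∈ ball x r, F (gradient ψ y) y + lam * (ψ y + d + δ) < 0 ∧
      lam * (ψ y + d + δ) < C := by
    intro y hy
    refine hgood (y, δ) ?_
    rw [mem_ball, Prod.dist_eq, max_lt_iff]
    refine ⟨(mem_ball.1 hy).trans_le (min_le_left _ _), ?_⟩
    rw [Real.dist_eq, sub_zero, abs_of_pos hδpos]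
    exact hδ1.trans_le (min_le_left _ _)
  have hψv : ∀ y ∈ ball x r, ψ y + d ≤ v y - ‖y - x‖ ^ 2 := by
    intro y hy
    have := hmin' y (ball_subset_ball (min_le_right _ _) hy)
    simp only [hψdef, hd]
    linarith
  classical
  set w : E → ℝ := fun y => if y ∈ ball x r then max (v y) (ψ y + d + δ) else v y with hw
  have hvw : ∀ y, v y ≤ w y := by
    intro y
    simp only [hw]
    split_ifs
    · exact le_max_left _ _
    · exact le_rfl
  have hwball : ∀ y ∈ ball x r, w y = max (v y) (ψ y + d + δ) := fun y hy => by
    simp only [hw, if_pos hy]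
  have hwout : ∀ y, r / 2 < ‖y - x‖ → w y = v y := by
    intro y hy
    by_cases hyb : y ∈ ball x r
    · rw [hwball y hyb, max_eq_left]
      have := hψv y hyb
      nlinarith
    · simp only [hw, if_neg hyb]
  have hwne : ∀ y, w y ≠ v y → y ∈ ball x r ∧ w y = ψ y + d + δ := by
    intro y hy
    have hyb : y ∈ ball x r := by
      by_contra hyb
      exact hy (by simp only [hw, if_neg hyb])
    refine ⟨hyb, ?_⟩
    rw [hwball y hyb] at hy ⊢
    rcases max_choice (v y) (ψ y + d + δ) with h | h
    · exact absurd h hy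
    · exact h
  have hwc : Continuous w := by
    refine continuous_iff_continuousAt.2 fun y => ?_
    by_cases hy : y ∈ ball x r
    · have hc : Continuous fun y => max (v y) (ψ y + d + δ) := by
        have := hψC.continuous
        fun_prop
      refine hc.continuousAt.congr ?_
      filter_upwards [isOpen_ball.mem_nhds hy] with z hz
      exact (hwball z hz).symm
    · refine hvc.continuousAt.congr ?_
      have hy' : r / 2 < ‖y - x‖ := by
        rw [mem_ball, dist_eq_norm, not_lt] at hy
        linarith
      have hopen : IsOpen {z : E | r / 2 < ‖z - x‖} :=
        isOpen_lt continuous_const (by fun_prop)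
      filter_upwards [hopen.mem_nhds hy'] with z hz
      exact (hwout z hz).symm
  have hwbd : ∀ y, |lam * w y| ≤ C := by
    intro y
    by_cases hy : w y = v y
    · rw [hy]; exact hbd y
    · obtain ⟨hyb, hyw⟩ := hwne y hy
      rw [abs_le]
      constructor
      · exact (abs_le.1 (hbd y)).1.trans (mul_le_mul_of_nonneg_left (hvw y) hlam.le)
      · rw [hyw]; exact (hin y hyb).2.le
  have hwsub : ViscositySub F (fun y => -(lam * w y)) w := by
    intro χ y hχ hmax
    by_cases hy : w y = v y
    · have := hsub χ y hχ (by
        filter_upwards [hmax] with z hz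
        have := hvw z
        linarith)
      simpa only [hy] using this
    · obtain ⟨hyb, hyw⟩ := hwne y hy
      have hext : IsLocalMax (fun z => ψ z + -χ z) y := by
        filter_upwards [hmax, isOpen_ball.mem_nhds hyb] with z hz hzb
        have : ψ z + d + δ ≤ w z := by rw [hwball z hzb]; exact le_max_right _ _
        linarith
      have h0 := IsLocalExtr.gradient_eq_zero (Or.inr hext)
      rw [((hψC.hasGradientAt y).add' (hχ.hasGradientAt y).neg').gradient] at h0
      have h1 : gradient χ y = gradient ψ y := (add_neg_eq_zero.1 h0).symm
      have := (hin y hyb).1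
      simp only [h1, hyw]
      linarith
  -- Coercivity returns the Lipschitz constant of the class: `lam * w ≥ -C` bounds `F` at touching
  -- gradients by `C`.
  have hwlip : ∀ y z, w z - w y ≤ K * ‖z - y‖ := by
    refine sub_le_of_gradient_le hwc (B := C / lam) (fun y => ?_) hK fun χ y hχ hmax => ?_
    · have := hwbd y
      rw [abs_mul, abs_of_pos hlam] at this
      rw [le_div_iff₀ hlam]
      linarith
    · refine hcoer _ y ((hwsub χ y hχ hmax).trans ?_)
      have := (abs_le.1 (hwbd y)).1
      simp only
      linarith
  have hfin := le_perronSup hlam (show w ∈ perronClass F C K lam from ⟨hwlip, hwbd, hwsub⟩) x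
  have hxb : x ∈ ball x r := mem_ball_self hrpos
  have h1 : ψ x + d + δ ≤ w x := by rw [hwball x hxb]; exact le_max_right _ _
  rw [← hv] at hfin
  linarith

end Perron

/-! ### Vanishing discount and the ergodic problem. -/

section Ergodic

/-- Equi-Lipschitz functions that converge on a finite net of a compact ball are close on the whole
ball. -/
theorem eventually_forall_closedBall_abs_sub_le {E : Type*} [SeminormedAddCommGroup E]
    [ProperSpace E] {ι : Type*} {l : Filter ι} {w : ι → E → ℝ}
    {u : E → ℝ} {K : ℝ} (hK : 0 ≤ K) (hw : ∀ i x y, w i y - w i x ≤ K * ‖y - x‖)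
    (hlim : ∀ x, Tendsto (fun i => w i x) l (𝓝 (u x)))
    (hu : ∀ x y, u y - u x ≤ K * ‖y - x‖) (x : E) {η : ℝ} (hη : 0 < η) :
    ∀ᶠ i in l, ∀ y ∈ closedBall x 1, |w i y - u y| ≤ η := by
  obtain ⟨t, -, htf, ht⟩ := (isCompact_closedBall x 1).finite_cover_balls
    (show 0 < η / (3 * (K + 1)) by positivity)
  have hev : ∀ᶠ i in l, ∀ z ∈ t, |w i z - u z| < η / 3 := by
    rw [eventually_all_finite htf]
    intro z _
    have := (Metric.tendsto_nhds.1 (hlim z)) (η / 3) (by positivity)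
    simpa only [Real.dist_eq] using this
  filter_upwards [hev] with i hi y hy
  obtain ⟨z, hz, hyz⟩ := mem_iUnion₂.1 (ht hy)
  rw [mem_ball, dist_eq_norm, lt_div_iff₀ (by positivity)] at hyz
  have h1 := hw i z y
  have h2 := hw i y z
  have h3 := hu z y
  have h4 := hu y z
  rw [norm_sub_rev z y] at h2 h4
  have h5 := abs_lt.1 (hi z hz)
  have h6 : K * ‖y - z‖ ≤ η / 3 := by nlinarith [norm_nonneg (y - z)]
  rw [abs_le]
  constructor <;> linarith [h5.1, h5.2]

variable {E : Type*} [NormedAddCommGroup E] [InnerProductSpace ℝ E] [ProperSpace E]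

theorem Ultrafilter.exists_tendsto_of_abs_le {ι : Type*} (𝒰 : Ultrafilter ι) {f : ι → ℝ} {B : ℝ}
    (hf : ∀ i, |f i| ≤ B) : ∃ L, Tendsto f 𝒰 (𝓝 L) := by
  obtain ⟨L, -, hL⟩ := (isCompact_Icc (a := -B) (b := B)).ultrafilter_le_nhds (𝒰.map f)
    (by
      rw [le_principal_iff]
      exact Filter.mem_map.2 (Filter.univ_mem' fun i => abs_le.1 (hf i)))
  exact ⟨L, hL⟩

/-- Solvability of the ergodic problem `F(Du, x) = c` for a coercive periodic `F`. -/
theorem exists_ergodic_solution {F : E → E → ℝ} {C K : ℝ} (hF : Continuous (Function.uncurry F))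
    (hC : ∀ x, |F 0 x| ≤ C) (hK : 0 ≤ K) (hcoer : ∀ q x, F q x ≤ C → ‖q‖ ≤ K) :
    ∃ (c : ℝ) (u : E → ℝ), (∀ k, (∀ q x, F q (x + k) = F q x) → ∀ x, u (x + k) = u x) ∧
      (∀ x y, u y - u x ≤ K * ‖y - x‖) ∧ ViscositySub F (fun _ => c) u ∧
      ViscositySuper F (fun _ => c) u := by
  set lam : ℕ → ℝ := fun i => 1 / ((i : ℝ) + 1) with hlam
  have hpos : ∀ i, 0 < lam i := fun i => by positivity
  set v : ℕ → E → ℝ := fun i => perronSup F C K (lam i) with hv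
  have hmem : ∀ i, v i ∈ perronClass F C K (lam i) := fun i => perronSup_mem hF hC hK (hpos i)
  have hsup : ∀ i, ViscositySuper F (fun x => -(lam i * v i x)) (v i) := fun i =>
    perronSup_super hF hC hK hcoer (hpos i)
  -- An ultrafilter yields all pointwise limits at once, in place of extracting subsequences.
  set 𝒰 : Ultrafilter ℕ := hyperfilter ℕ with h𝒰
  have hle : (𝒰 : Filter ℕ) ≤ atTop := Nat.hyperfilter_le_atTop
  obtain ⟨c, hc⟩ := 𝒰.exists_tendsto_of_abs_le (f := fun i => -(lam i * v i 0)) (B := C)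
    fun i => by rw [abs_neg]; exact (hmem i).2.1 0
  -- Only `lam i * v i` is uniformly bounded; subtracting the value at the origin leaves a locally
  -- bounded family.
  set w : ℕ → E → ℝ := fun i x => v i x - v i 0 with hw
  have hwlip : ∀ i x y, w i y - w i x ≤ K * ‖y - x‖ := fun i x y => by
    simpa [hw] using (hmem i).1 x y
  have hwc : ∀ i, Continuous (w i) := fun i => (lipschitzWith_of_sub_le hK (hwlip i)).continuous
  have hex : ∀ x, ∃ L, Tendsto (fun i => w i x) 𝒰 (𝓝 L) := fun x =>
    𝒰.exists_tendsto_of_abs_le (B := K * ‖x‖) fun i => by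
      have h1 := (hmem i).1 0 x
      have h2 := (hmem i).1 x 0
      simp only [sub_zero, zero_sub, norm_neg] at h1 h2
      rw [abs_le]
      constructor <;> simp only [hw] <;> linarith
  choose u hu using hex
  have hulip : ∀ x y, u y - u x ≤ K * ‖y - x‖ := fun x y =>
    le_of_tendsto ((hu y).sub (hu x)) (Eventually.of_forall fun i => hwlip i x y)
  have hclose : ∀ x η, 0 < η → ∀ᶠ i in (𝒰 : Filter ℕ), ∀ y ∈ closedBall x 1,
      |w i y - u y| ≤ η := fun x η hη =>
    eventually_forall_closedBall_abs_sub_le hK hwlip hu hulip x hη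
  -- The discounted term varies over the ball by at most `lam i * K * (‖x‖ + 1)` from its value at
  -- `0`, so its limit is the constant `c`.
  have hA : ∀ x κ, 0 < κ → ∀ᶠ i in (𝒰 : Filter ℕ), ∀ y ∈ ball x 1,
      |-(lam i * v i y) - c| ≤ κ := by
    intro x κ hκ
    have hl : Tendsto (fun i => lam i * (K * (‖x‖ + 1))) atTop (𝓝 0) := by
      have := (tendsto_one_div_add_atTop_nhds_zero_nat (𝕜 := ℝ)).mul_const (K * (‖x‖ + 1))
      rwa [zero_mul] at this
    filter_upwards [hle (hl.eventually (gt_mem_nhds (half_pos hκ))),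
      Metric.tendsto_nhds.1 hc (κ / 2) (half_pos hκ)] with i hi1 hi2 y hy
    rw [Real.dist_eq] at hi2
    have h1 := (hmem i).1 0 y
    have h2 := (hmem i).1 y 0
    simp only [sub_zero, zero_sub, norm_neg] at h1 h2
    have hy' : ‖y‖ ≤ ‖x‖ + 1 := by
      rw [mem_ball, dist_eq_norm] at hy
      have := norm_le_norm_add_norm_sub' y x
      linarith
    have h3 : K * ‖y‖ ≤ K * (‖x‖ + 1) := mul_le_mul_of_nonneg_left hy' hK
    have h4 := mul_le_mul_of_nonneg_left (h1.trans h3) (hpos i).le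
    have h5 := mul_le_mul_of_nonneg_left (h2.trans h3) (hpos i).le
    rw [mul_sub] at h4 h5
    have h6 := abs_lt.1 hi2
    rw [abs_le]
    constructor <;> linarith [h6.1, h6.2]
  refine ⟨c, u, fun k hk x => ?_, hulip, ?_, ?_⟩
  · refine tendsto_nhds_unique (hu (x + k)) ((hu x).congr fun i => ?_)
    simp only [hw, hv]
    rw [perronSup_periodic hk (hpos i) hC hK]
  · intro φ x hφ hmax
    refine viscositySub_le_of_approx hF (l := (𝒰 : Filter ℕ)) (w := w)
      (A := fun i y => -(lam i * v i y)) (Eventually.of_forall hwc)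
      (Eventually.of_forall fun i => (hmem i).2.2.sub_const _) hφ hmax ?_ ?_ ?_
    · intro η hη
      filter_upwards [hclose x η hη] with i hi y hy
      linarith [(abs_le.1 (hi y hy)).2]
    · intro η hη
      filter_upwards [hclose x η hη] with i hi
      linarith [(abs_le.1 (hi x (mem_closedBall_self zero_le_one))).1]
    · intro κ hκ
      refine ⟨1, one_pos, ?_⟩
      filter_upwards [hA x κ hκ] with i hi y hy
      linarith [(abs_le.1 (hi y hy)).2]
  · rw [← viscositySub_neg_iff]
    intro φ x hφ hmax
    refine viscositySub_le_of_approx (F := fun q x => -F (-q) x)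
      (hF.comp (by fun_prop : Continuous fun p : E × E => (-p.1, p.2))).neg
      (l := (𝒰 : Filter ℕ)) (w := fun i x => -w i x)
      (A := fun i y => - -(lam i * v i y)) (Eventually.of_forall fun i => (hwc i).neg)
      (Eventually.of_forall fun i => viscositySub_neg_iff.2 ((hsup i).sub_const _)) hφ hmax
      ?_ ?_ ?_
    · intro η hη
      filter_upwards [hclose x η hη] with i hi y hy
      linarith [(abs_le.1 (hi y hy)).1]
    · intro η hη
      filter_upwards [hclose x η hη] with i hi
      linarith [(abs_le.1 (hi x (mem_closedBall_self zero_le_one))).2]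
    · intro κ hκ
      refine ⟨1, one_pos, ?_⟩
      filter_upwards [hA x κ hκ] with i hi y hy
      linarith [(abs_le.1 (hi y hy)).1]

end Ergodic

/-! ### Periodic functions and the unit cube. -/

section Lattice

variable {n : ℕ}

/-- The integer vector with the given coordinates. -/
def latticeVec (k : Fin n → ℤ) : EuclideanSpace ℝ (Fin n) :=
  WithLp.toLp 2 fun i => (k i : ℝ)

theorem latticeVec_apply (k : Fin n → ℤ) (i : Fin n) : latticeVec k i = k i := rfl

theorem exists_add_latticeVec_mem_unitCube (x : EuclideanSpace ℝ (Fin n)) :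
    ∃ k : Fin n → ℤ, x + latticeVec k ∈ unitCube n := by
  refine ⟨fun i => -⌊x i⌋, fun i => ?_⟩
  simp only [PiLp.add_apply, latticeVec_apply, Int.cast_neg, ← sub_eq_add_neg]
  exact ⟨Int.fract_nonneg _, (Int.fract_lt_one _).le⟩

theorem isCompact_unitCube : IsCompact (unitCube n) := by
  have h : unitCube n = (EuclideanSpace.equiv (Fin n) ℝ).symm '' (Set.pi univ fun _ => Icc 0 1) := by
    ext x
    constructor
    · intro hx
      exact ⟨EuclideanSpace.equiv (Fin n) ℝ x, fun i _ => hx i, by simp⟩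
    · rintro ⟨y, hy, rfl⟩ i
      exact hy i trivial
  rw [h]
  exact (isCompact_univ_pi fun _ => isCompact_Icc).image (EuclideanSpace.equiv (Fin n) ℝ).symm.continuous

variable {F : Type*}

theorem IsLatticePeriodic.exists_mem_unitCube {f : EuclideanSpace ℝ (Fin n) → F}
    (hf : IsLatticePeriodic f) (x : EuclideanSpace ℝ (Fin n)) : ∃ y ∈ unitCube n, f y = f x := by
  obtain ⟨k, hk⟩ := exists_add_latticeVec_mem_unitCube x
  exact ⟨_, hk, hf k x⟩

theorem IsLatticePeriodic.exists_norm_le [NormedAddCommGroup F]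
    {f : EuclideanSpace ℝ (Fin n) → F} (hf : IsLatticePeriodic f) (hc : Continuous f) :
    ∃ M, 0 ≤ M ∧ ∀ x, ‖f x‖ ≤ M := by
  obtain ⟨M, hM⟩ := isCompact_unitCube.exists_bound_of_continuousOn hc.continuousOn
  have h : ∀ x, ‖f x‖ ≤ M := fun x => by
    obtain ⟨y, hy, hxy⟩ := hf.exists_mem_unitCube x
    rw [← hxy]; exact hM y hy
  exact ⟨M, (norm_nonneg _).trans (h 0), h⟩

theorem unitCube_nonempty : (unitCube n).Nonempty := ⟨0, fun i => by simp⟩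

theorem IsLatticePeriodic.exists_forall_le {f : EuclideanSpace ℝ (Fin n) → ℝ}
    (hf : IsLatticePeriodic f) (hc : Continuous f) : ∃ y, ∀ x, f x ≤ f y := by
  obtain ⟨y, -, hy⟩ := isCompact_unitCube.exists_isMaxOn unitCube_nonempty hc.continuousOn
  refine ⟨y, fun x => ?_⟩
  obtain ⟨z, hz, hzx⟩ := hf.exists_mem_unitCube x
  rw [← hzx]
  exact hy hz

theorem IsLatticePeriodic.exists_forall_ge {f : EuclideanSpace ℝ (Fin n) → ℝ}
    (hf : IsLatticePeriodic f) (hc : Continuous f) : ∃ y, ∀ x, f y ≤ f x := by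
  obtain ⟨y, hy⟩ := IsLatticePeriodic.exists_forall_le (f := fun x => -f x)
    (fun k x => congrArg _ (hf k x)) hc.neg
  exact ⟨y, fun x => neg_le_neg_iff.1 (hy x)⟩

theorem IsLatticePeriodic.fderiv [NormedAddCommGroup F] [NormedSpace ℝ F]
    {f : EuclideanSpace ℝ (Fin n) → F} (hf : IsLatticePeriodic f) :
    IsLatticePeriodic (fderiv ℝ f) := by
  intro k x
  rw [← fderiv_comp_add_right]
  congr 1
  ext y
  exact hf k y

theorem IsLatticePeriodic.gradient {f : EuclideanSpace ℝ (Fin n) → ℝ}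
    (hf : IsLatticePeriodic f) : IsLatticePeriodic (gradient f) := by
  intro k x
  simp only [_root_.gradient, hf.fderiv k x]

theorem IsLatticePeriodic.exists_norm_sub_le [NormedAddCommGroup F] [NormedSpace ℝ F]
    {f : EuclideanSpace ℝ (Fin n) → F} (hf : IsLatticePeriodic f) (hC : ContDiff ℝ 1 f) :
    ∃ L, 0 ≤ L ∧ ∀ x y, ‖f x - f y‖ ≤ L * ‖x - y‖ := by
  obtain ⟨L, hL, h⟩ := hf.fderiv.exists_norm_le (hC.continuous_fderiv one_ne_zero)
  refine ⟨L, hL, fun x y => ?_⟩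
  exact (convex_univ.norm_image_sub_le_of_norm_fderiv_le
    (fun z _ => hC.differentiable one_ne_zero z) (fun z _ => h z) (mem_univ y) (mem_univ x))

end Lattice

/-! ### Existence, uniqueness and bounds for the ergodic constant. -/

section CellProblem

variable {n : ℕ} {b : EuclideanSpace ℝ (Fin n) → EuclideanSpace ℝ (Fin n)}
  {p : EuclideanSpace ℝ (Fin n)} {c : ℝ}

/-- The quadratic term dominates the bounded drift: once `‖p + q‖ > M + C + 1` the Hamiltonian
exceeds `C`, which is the coercivity that `exists_ergodic_solution` needs. -/
theorem exists_isErgodicConstant (hb : Continuous b) (hper : IsLatticePeriodic b)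
    (p : EuclideanSpace ℝ (Fin n)) : ∃ c, IsErgodicConstant b p c := by
  obtain ⟨M, hM, hbM⟩ := hper.exists_norm_le hb
  have hinner : ∀ q x, |inner ℝ (b x) q| ≤ M * ‖q‖ := fun q x =>
    (abs_real_inner_le_norm _ _).trans (mul_le_mul_of_nonneg_right (hbM x) (norm_nonneg _))
  set C := ‖p‖ ^ 2 + M * ‖p‖ with hC
  have hCnn : 0 ≤ C := by positivity
  have hF : Continuous (Function.uncurry fun q x => flowHamiltonian b (p + q) x) := by
    simp only [Function.uncurry_def, flowHamiltonian]
    fun_prop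
  obtain ⟨c, u, huper, hulip, hsub, hsup⟩ := exists_ergodic_solution
    (F := fun q x => flowHamiltonian b (p + q) x) (C := C) (K := ‖p‖ + (M + C + 1)) hF
    (fun x => by
      simp only [flowHamiltonian, add_zero, hC]
      have := abs_le.1 (hinner p x)
      rw [abs_le]
      constructor <;> nlinarith [sq_nonneg ‖p‖]) (by positivity)
    (fun q x h => by
      simp only [flowHamiltonian] at h
      have h1 := (abs_le.1 (hinner (p + q) x)).1
      have h2 : ‖p + q‖ ≤ M + C + 1 := by
        by_contra hcon
        push Not at hcon
        nlinarith
      have h3 : ‖q‖ ≤ ‖p‖ + ‖p + q‖ := by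
        have := norm_sub_le (p + q) p
        rw [add_sub_cancel_left] at this
        linarith
      linarith)
  refine ⟨c, u, fun k x => huper _ (fun q y => ?_) x,
    ⟨_, lipschitzWith_of_sub_le (by positivity) hulip⟩, hsub, hsup⟩
  simp only [flowHamiltonian, hper k y]

/-- Comparison of the constants of a subsolution and a supersolution. -/
theorem le_of_isCellSubsolution_of_isCellSupersolution {L : ℝ} (hL : 0 ≤ L)
    (hb : ∀ x y, ‖b x - b y‖ ≤ L * ‖x - y‖) {c₁ c₂ : ℝ} {u₁ u₂ : EuclideanSpace ℝ (Fin n) → ℝ}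
    (hper₁ : IsLatticePeriodic u₁) (hper₂ : IsLatticePeriodic u₂) {K : NNReal}
    (hlip : LipschitzWith K u₁) (hc₂ : Continuous u₂) (h₁ : IsCellSubsolution b p c₁ u₁)
    (h₂ : IsCellSupersolution b p c₂ u₂) : c₂ ≤ c₁ := by
  have hc₁ := hlip.continuous
  obtain ⟨B₁, hB₁, hu₁⟩ := hper₁.exists_norm_le hc₁
  obtain ⟨B₂, hB₂, hu₂⟩ := hper₂.exists_norm_le hc₂
  -- Doubling of variables with penalty `A`: both inequalities are tested with the same gradient
  -- `q`, and only the variation of `b` between `x` and `y` remains.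
  have key : ∀ A > 0, c₂ - c₁ ≤ L * (K / A) * (‖p‖ + 2 * K) := by
    intro A hA
    set Φ : EuclideanSpace ℝ (Fin n) × EuclideanSpace ℝ (Fin n) → ℝ :=
      fun z => u₁ z.1 - u₂ z.2 - A * ‖z.1 - z.2‖ ^ 2 with hΦ
    have hΦc : Continuous Φ := by fun_prop
    -- Beyond separation `R` the penalty outweighs the oscillation of `u₂`. With the first point
    -- moved into the cube by periodicity, the maximisation becomes compact.
    set R := (2 * B₁ + 2 * B₂) / A + 1 with hR
    have hRpos : 0 < R := by positivity
    obtain ⟨D, hD⟩ := isCompact_unitCube (n := n).isBounded.exists_norm_le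
    obtain ⟨⟨x, y⟩, -, hmax⟩ := (isCompact_unitCube (n := n).prod
      (isCompact_closedBall (0 : EuclideanSpace ℝ (Fin n)) (D + R))).exists_isMaxOn
      ⟨(0, 0), fun i => by simp, by
        have : 0 ≤ D := (norm_nonneg _).trans (hD 0 fun i => by simp)
        simp only [mem_closedBall, dist_self]; positivity⟩ hΦc.continuousOn
    have hglob : ∀ z, Φ z ≤ Φ (x, y) := by
      have hcube : ∀ z, z.1 ∈ unitCube n → Φ z ≤ Φ (x, y) := by
        rintro ⟨z₁, z₂⟩ hz
        simp only at hz
        by_cases hfar : ‖z₁ - z₂‖ ≤ R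
        · refine isMaxOn_iff.1 hmax _ ⟨hz, ?_⟩
          rw [mem_closedBall, dist_zero_right]
          have h1 := hD z₁ hz
          have h2 := norm_le_norm_add_norm_sub z₁ z₂
          linarith
        · have hdiag : Φ (z₁, z₁) ≤ Φ (x, y) := by
            refine isMaxOn_iff.1 hmax _ ⟨hz, ?_⟩
            rw [mem_closedBall, dist_zero_right]
            have h1 := hD z₁ hz
            linarith
          refine le_trans ?_ hdiag
          push Not at hfar
          have h1 : 2 * B₁ + 2 * B₂ ≤ A * ‖z₁ - z₂‖ ^ 2 := by
            have h3 : R * 1 ≤ ‖z₁ - z₂‖ ^ 2 := by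
              have h4 : 1 ≤ R := by
                have : 0 ≤ (2 * B₁ + 2 * B₂) / A := by positivity
                linarith
              nlinarith
            have h5 : A * R = 2 * B₁ + 2 * B₂ + A := by rw [hR]; field_simp
            nlinarith
          have h2 := abs_le.1 (hu₂ z₁)
          have h3 := abs_le.1 (hu₂ z₂)
          simp only [hΦ, sub_self, norm_zero]
          linarith [h2.1, h2.2, h3.1, h3.2]
      rintro ⟨z₁, z₂⟩
      obtain ⟨k, hk⟩ := exists_add_latticeVec_mem_unitCube z₁
      have := hcube (z₁ + latticeVec k, z₂ + latticeVec k) hk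
      have e : Φ (z₁ + latticeVec k, z₂ + latticeVec k) = Φ (z₁, z₂) := by
        have e1 := hper₁ k z₁
        have e2 := hper₂ k z₂
        simp only [hΦ, latticeVec, add_sub_add_right_eq_sub, e1, e2]
      rwa [e] at this
    -- Comparison with the diagonal point `(y, y)`: the penalty is at most the Lipschitz increment
    -- of `u₁`.
    have hxy : A * ‖x - y‖ ≤ K := by
      have h1 := hglob (y, y)
      have h2 := (le_abs_self _).trans (hlip.dist_le_mul x y)
      rw [dist_eq_norm] at h2
      simp only [hΦ, sub_self, norm_zero] at h1
      rcases (norm_nonneg (x - y)).eq_or_lt with h0 | h0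
      · rw [← h0, mul_zero]; exact K.2
      · refine le_of_mul_le_mul_right ?_ h0
        nlinarith
    have hgsub : HasGradientAt (fun z => A * ‖z - y‖ ^ 2) (A • (2 : ℝ) • (x - y)) x :=
      (hasGradientAt_norm_sub_sq y x).const_mul' A
    have hgsup : HasGradientAt (fun z => (-A) * ‖z - x‖ ^ 2) ((-A) • (2 : ℝ) • (y - x)) y :=
      (hasGradientAt_norm_sub_sq x y).const_mul' (-A)
    have hC : ∀ (a : ℝ) (y : EuclideanSpace ℝ (Fin n)),
        ContDiff ℝ 1 fun z => a * ‖z - y‖ ^ 2 := fun a y =>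
      contDiff_const.mul ((contDiff_id.sub contDiff_const).norm_sq ℝ)
    have e1 := h₁ _ x (hC A y) (Eventually.of_forall fun z => by
      have := hglob (z, y)
      simp only [hΦ] at this
      linarith)
    have e2 := h₂ _ y (hC (-A) x) (Eventually.of_forall fun z => by
      have := hglob (x, z)
      simp only [hΦ] at this
      rw [norm_sub_rev x y, norm_sub_rev x z] at this
      simp only
      linarith)
    rw [hgsub.gradient] at e1
    have hq : (-A) • (2 : ℝ) • (y - x) = A • (2 : ℝ) • (x - y) := by
      module
    rw [hgsup.gradient, hq] at e2
    simp only [flowHamiltonian] at e1 e2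
    set q := A • (2 : ℝ) • (x - y) with hqdef
    have hqn : ‖q‖ ≤ 2 * K := by
      rw [hqdef, norm_smul, norm_smul, Real.norm_of_nonneg hA.le,
        Real.norm_of_nonneg zero_le_two]
      linarith
    have e3 : c₂ - c₁ ≤ inner ℝ (b y - b x) (p + q) := by
      rw [inner_sub_left]; linarith
    refine e3.trans ((real_inner_le_norm _ _).trans ?_)
    have h4 : ‖y - x‖ ≤ K / A := by
      rw [le_div_iff₀ hA, norm_sub_rev]; linarith
    have h5 : ‖b y - b x‖ ≤ L * (K / A) := (hb y x).trans (by gcongr)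
    have h6 : ‖p + q‖ ≤ ‖p‖ + 2 * K := (norm_add_le _ _).trans (by gcongr)
    have : 0 ≤ K / A := by positivity
    gcongr
  have hlim : Tendsto (fun A : ℝ => L * (K / A) * (‖p‖ + 2 * K)) atTop
      (𝓝 (L * 0 * (‖p‖ + 2 * K))) :=
    ((tendsto_const_nhds.div_atTop tendsto_id).const_mul L).mul_const _
  have := ge_of_tendsto hlim ((eventually_gt_atTop 0).mono key)
  simp only [mul_zero, zero_mul] at this
  linarith

theorem existsUnique_isErgodicConstant (hb : ContDiff ℝ 1 b) (hper : IsLatticePeriodic b)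
    (p : EuclideanSpace ℝ (Fin n)) : ∃! c, IsErgodicConstant b p c := by
  obtain ⟨c, hc⟩ := exists_isErgodicConstant hb.continuous hper p
  obtain ⟨L, hL, hbL⟩ := hper.exists_norm_sub_le hb
  have hle : ∀ c₁ c₂, IsErgodicConstant b p c₁ → IsErgodicConstant b p c₂ → c₂ ≤ c₁ := by
    rintro c₁ c₂ ⟨u₁, hp₁, ⟨K₁, hK₁⟩, hs₁, -⟩ ⟨u₂, hp₂, ⟨K₂, hK₂⟩, -, hs₂⟩
    exact le_of_isCellSubsolution_of_isCellSupersolution hL hbL hp₁ hp₂ hK₁ hK₂.continuous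
      hs₁ hs₂
  exact ⟨c, hc, fun c' hc' => le_antisymm (hle _ _ hc hc') (hle _ _ hc' hc)⟩

theorem isErgodicConstant_effectiveHamiltonian (hb : Continuous b) (hper : IsLatticePeriodic b)
    (p : EuclideanSpace ℝ (Fin n)) : IsErgodicConstant b p (effectiveHamiltonian b p) :=
  Classical.epsilon_spec (exists_isErgodicConstant hb hper p)

/-- A periodic function of class `C¹` bounds the ergodic constant from above. -/
theorem IsErgodicConstant.le_of_forall_le (hc : IsErgodicConstant b p c)
    {φ : EuclideanSpace ℝ (Fin n) → ℝ} (hφ : ContDiff ℝ 1 φ) (hper : IsLatticePeriodic φ) {C : ℝ}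
    (h : ∀ x, flowHamiltonian b (p + gradient φ x) x ≤ C) : c ≤ C := by
  obtain ⟨u, hu, ⟨K, hK⟩, -, hsup⟩ := hc
  obtain ⟨y, hy⟩ := IsLatticePeriodic.exists_forall_ge (f := fun x => u x - φ x)
    (fun k x => congrArg₂ _ (hu k x) (hper k x)) (hK.continuous.sub hφ.continuous)
  exact (hsup φ y hφ (Eventually.of_forall hy)).trans (h y)

/-- At a maximum of the solution, constants are admissible test functions. -/
theorem IsErgodicConstant.le_of_forall_ge (hc : IsErgodicConstant b p c) {C : ℝ}
    (h : ∀ x, C ≤ flowHamiltonian b p x) : C ≤ c := by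
  obtain ⟨u, hu, ⟨K, hK⟩, hsub, -⟩ := hc
  obtain ⟨y, hy⟩ := hu.exists_forall_le hK.continuous
  have := hsub (fun _ => 0) y contDiff_const (Eventually.of_forall fun x => by simpa using hy x)
  rw [gradient_fun_const, add_zero] at this
  exact (h y).trans this

theorem IsErgodicConstant.sq_sub_le (hc : IsErgodicConstant b p c) {M : ℝ}
    (hM : ∀ x, ‖b x‖ ≤ M) : ‖p‖ ^ 2 - M * ‖p‖ ≤ c := by
  refine hc.le_of_forall_ge fun x => ?_
  have h1 := (abs_le.1 (abs_real_inner_le_norm (b x) p)).1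
  have h2 := mul_le_mul_of_nonneg_right (hM x) (norm_nonneg p)
  simp only [flowHamiltonian]
  linarith

end CellProblem

/-! ### Averages along lines and the linear corrector. -/

section LineAverage

variable {n : ℕ}

/-- The average of `f` over the segment from `x` to `x + T • p`. -/
noncomputable def lineAvg (f : EuclideanSpace ℝ (Fin n) → ℝ) (p : EuclideanSpace ℝ (Fin n))
    (T : ℝ) (x : EuclideanSpace ℝ (Fin n)) : ℝ :=
  T⁻¹ * ∫ s in (0 : ℝ)..T, f (x + s • p)

variable {f : EuclideanSpace ℝ (Fin n) → ℝ}

theorem continuous_lineAvg (hf : Continuous f) (p : EuclideanSpace ℝ (Fin n)) (T : ℝ) :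
    Continuous (lineAvg f p T) := by
  have : Continuous (Function.uncurry fun (x : EuclideanSpace ℝ (Fin n)) (s : ℝ) =>
      f (x + s • p)) := hf.comp (by fun_prop)
  exact continuous_const.mul
    (intervalIntegral.continuous_parametric_intervalIntegral_of_continuous' this 0 T)

/-- Lines in an integer direction close up at time `1`, and an integral over a full period ignores
the starting point. -/
theorem lineAvg_latticeVec_add_smul (hf : IsLatticePeriodic f) (k : Fin n → ℤ)
    (x : EuclideanSpace ℝ (Fin n)) (t : ℝ) :
    lineAvg f (latticeVec k) 1 (x + t • latticeVec k) = lineAvg f (latticeVec k) 1 x := by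
  have hg : Function.Periodic (fun s : ℝ => f (x + s • latticeVec k)) 1 := fun s => by
    have := hf k (x + s • latticeVec k)
    refine Eq.trans ?_ this
    change f _ = f (_ + latticeVec k)
    congr 1
    module
  have h1 := hg.intervalIntegral_add_eq t 0
  have h2 := intervalIntegral.integral_comp_add_left (a := 0) (b := 1)
    (fun s : ℝ => f (x + s • latticeVec k)) t
  simp only [zero_add, add_zero] at h1 h2
  rw [h1] at h2
  simp only [lineAvg, ← h2]
  congr 1
  refine intervalIntegral.integral_congr fun s _ => congrArg f ?_
  module

/-- Solution of the linear transport equation `p · Dφ = f - lineAvg f p T`. -/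
theorem exists_corrector (hf : ContDiff ℝ 1 f) (hper : IsLatticePeriodic f)
    (p : EuclideanSpace ℝ (Fin n)) {T : ℝ} (hT : T ≠ 0) :
    ∃ φ : EuclideanSpace ℝ (Fin n) → ℝ, ContDiff ℝ 1 φ ∧ IsLatticePeriodic φ ∧
      ∀ x, inner ℝ (gradient φ x) p = f x - lineAvg f p T x := by
  obtain ⟨M, hM, hfM⟩ := hper.fderiv.exists_norm_le (hf.continuous_fderiv one_ne_zero)
  have hfd := hf.continuous_fderiv one_ne_zero
  have hfc := hf.continuous
  set D : EuclideanSpace ℝ (Fin n) → ℝ → EuclideanSpace ℝ (Fin n) →L[ℝ] ℝ :=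
    fun x s => (s / T - 1) • fderiv ℝ f (x + s • p) with hD
  have hDc : Continuous (Function.uncurry D) := by
    simp only [hD, Function.uncurry_def]
    fun_prop
  have hder : ∀ x, HasFDerivAt (fun x => ∫ s in (0 : ℝ)..T, (s / T - 1) * f (x + s • p))
      (∫ s in (0 : ℝ)..T, D x s) x := by
    intro x
    refine (intervalIntegral.hasFDerivAt_integral_of_dominated_of_fderiv_le
      (bound := fun s => |s / T - 1| * M) univ_mem ?_ ?_ ?_ ?_ ?_ ?_)
    · exact Eventually.of_forall fun x => Continuous.aestronglyMeasurable (by fun_prop)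
    · exact Continuous.intervalIntegrable (by fun_prop) _ _
    · exact (hDc.comp (Continuous.prodMk_right x)).aestronglyMeasurable
    · refine Eventually.of_forall fun s _ x _ => ?_
      rw [hD, norm_smul, Real.norm_eq_abs]
      exact mul_le_mul_of_nonneg_left (hfM _) (abs_nonneg _)
    · exact Continuous.intervalIntegrable (by fun_prop) _ _
    · refine Eventually.of_forall fun s _ x _ => ?_
      have h1 : HasFDerivAt f (fderiv ℝ f (x + s • p)) (x + s • p) :=
        (hf.differentiable one_ne_zero _).hasFDerivAt
      exact (h1.comp x ((hasFDerivAt_id x).add_const (s • p))).const_mul (s / T - 1)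
  -- The weight is `-1` at `0`, vanishes at `T` and has derivative `1 / T`. Integrating by parts,
  -- the boundary term gives `f x` and the remaining integral the average.
  refine ⟨fun x => ∫ s in (0 : ℝ)..T, (s / T - 1) * f (x + s • p), ?_, ?_, fun x => ?_⟩
  · rw [contDiff_one_iff_fderiv]
    refine ⟨fun x => (hder x).differentiableAt, ?_⟩
    rw [funext fun x => (hder x).fderiv]
    exact intervalIntegral.continuous_parametric_intervalIntegral_of_continuous' hDc 0 T
  · intro k x
    refine intervalIntegral.integral_congr fun s _ => congrArg (fun y => (s / T - 1) * y) ?_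
    rw [add_right_comm, hper k]
  · have hDi : IntervalIntegrable (D x) MeasureTheory.volume 0 T :=
      (hDc.comp (Continuous.prodMk_right x)).intervalIntegrable _ _
    rw [inner_gradient_left, (hder x).fderiv, ContinuousLinearMap.intervalIntegral_apply hDi]
    have hline : ∀ s : ℝ, HasDerivAt (fun s : ℝ => f (x + s • p))
        (fderiv ℝ f (x + s • p) p) s := by
      intro s
      have h1 : HasFDerivAt f (fderiv ℝ f (x + s • p)) (x + s • p) :=
        (hf.differentiable one_ne_zero _).hasFDerivAt
      have h2 : HasDerivAt (fun s : ℝ => x + s • p) p s := by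
        simpa using ((hasDerivAt_id s).smul_const p).const_add x
      exact h1.comp_hasDerivAt s h2
    have hw : ∀ s : ℝ, HasDerivAt (fun s : ℝ => s / T - 1) (1 / T) s := fun s =>
      ((hasDerivAt_id s).div_const T).sub_const 1
    have := intervalIntegral.integral_mul_deriv_eq_deriv_mul (a := 0) (b := T)
      (fun s _ => hw s) (fun s _ => hline s)
      intervalIntegrable_const (Continuous.intervalIntegrable (by fun_prop) _ _)
    simp only [hD, FunLike.coe_smul, Pi.smul_apply, smul_eq_mul]
    rw [this, lineAvg, intervalIntegral.integral_const_mul]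
    simp [div_self hT]

end LineAverage

/-! ### First order bounds for the ergodic constant. -/

section Bounds

variable {n : ℕ} {V : EuclideanSpace ℝ (Fin n) → EuclideanSpace ℝ (Fin n)}

/-- The component of `V` in the direction `p`. -/
noncomputable def dirComp (V : EuclideanSpace ℝ (Fin n) → EuclideanSpace ℝ (Fin n))
    (p x : EuclideanSpace ℝ (Fin n)) : ℝ :=
  inner ℝ (V x) p

theorem contDiff_dirComp (hV : ContDiff ℝ 1 V) (p : EuclideanSpace ℝ (Fin n)) :
    ContDiff ℝ 1 (dirComp V p) :=
  hV.inner ℝ contDiff_const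

theorem isLatticePeriodic_dirComp (hper : IsLatticePeriodic V) (p : EuclideanSpace ℝ (Fin n)) :
    IsLatticePeriodic (dirComp V p) := fun k x => by
  simp only [dirComp, hper k x]

/-- Separates what the corrector can cancel, `2 ⟨g, p⟩ + ⟨b, p⟩`, from the bracket, which is of
order `ε²` when `g` and `b` are of order `ε`. -/
theorem flowHamiltonian_add (b : EuclideanSpace ℝ (Fin n) → EuclideanSpace ℝ (Fin n))
    (p g x : EuclideanSpace ℝ (Fin n)) :
    flowHamiltonian b (p + g) x =
      ‖p‖ ^ 2 + 2 * inner ℝ g p + inner ℝ (b x) p + (‖g‖ ^ 2 + inner ℝ (b x) g) := by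
  simp only [flowHamiltonian]
  rw [norm_add_sq_real, inner_add_right, real_inner_comm p g]
  ring

/-- Upper bound for the ergodic constant in terms of line averages of the flow. -/
theorem exists_ergodicConstant_le (hV : ContDiff ℝ 1 V) (hper : IsLatticePeriodic V)
    (p : EuclideanSpace ℝ (Fin n)) {T δ : ℝ} (hT : T ≠ 0)
    (hδ : ∀ x, lineAvg (dirComp V p) p T x ≤ δ) :
    ∃ C, 0 ≤ C ∧ ∀ ε > 0, ∀ c, IsErgodicConstant (fun x => ε • V x) p c →
      c ≤ ‖p‖ ^ 2 + ε * δ + C * ε ^ 2 := by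
  obtain ⟨M, hM, hVM⟩ := hper.exists_norm_le hV.continuous
  obtain ⟨φ, hφ, hφper, hφp⟩ :=
    exists_corrector (contDiff_dirComp hV p) (isLatticePeriodic_dirComp hper p) p hT
  obtain ⟨G, hG, hφG⟩ := hφper.gradient.exists_norm_le hφ.continuous_gradient
  refine ⟨G ^ 2 + M * G, by positivity, fun ε hε c hc => ?_⟩
  -- The factor `-ε / 2` makes `2 ⟨g, p⟩` cancel `ε ⟨V, p⟩` up to `ε` times the line average.
  refine hc.le_of_forall_le (φ := fun x => (-(ε / 2)) * φ x) (contDiff_const.mul hφ)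
    (fun k x => congrArg _ (hφper k x)) fun x => ?_
  rw [((hφ.hasGradientAt x).const_mul' (-(ε / 2))).gradient, flowHamiltonian_add,
    real_inner_smul_left, hφp, real_inner_smul_left, real_inner_smul_left, real_inner_smul_right,
    norm_smul, Real.norm_eq_abs, abs_neg, abs_of_pos (half_pos hε)]
  have h1 : inner ℝ (V x) p = dirComp V p x := rfl
  rw [h1]
  have h2 := (abs_le.1 (abs_real_inner_le_norm (V x) (gradient φ x))).1
  have h3 : ‖V x‖ * ‖gradient φ x‖ ≤ M * G :=
    mul_le_mul (hVM x) (hφG x) (norm_nonneg _) hM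
  have h4 : ‖gradient φ x‖ ^ 2 ≤ G ^ 2 := pow_le_pow_left₀ (norm_nonneg _) (hφG x) 2
  have h5 := mul_le_mul_of_nonneg_left (hδ x) hε.le
  have h6 : 0 ≤ M * G := mul_nonneg hM hG
  have h7 : -(ε ^ 2 / 2) * inner ℝ (V x) (gradient φ x) ≤ ε ^ 2 * (M * G) := by
    nlinarith [sq_nonneg ε]
  have h8 : (ε / 2 * ‖gradient φ x‖) ^ 2 ≤ ε ^ 2 * G ^ 2 := by
    rw [mul_pow]
    nlinarith [sq_nonneg ε, sq_nonneg ‖gradient φ x‖]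
  nlinarith

/-- Lower bound for the ergodic constant in a rational direction. -/
theorem le_ergodicConstant (hV : ContDiff ℝ 1 V) (hper : IsLatticePeriodic V) {M : ℝ}
    (hM : ∀ x, ‖V x‖ ≤ M) {k : Fin n → ℤ} (hk : latticeVec k ≠ 0) {ε lam c : ℝ} (hε : 0 < ε)
    (hc : IsErgodicConstant (fun x => ε • V x) (lam • latticeVec k) c)
    (x₀ : EuclideanSpace ℝ (Fin n)) :
    ‖lam • latticeVec k‖ ^ 2 +
      ε * lam * lineAvg (dirComp V (latticeVec k)) (latticeVec k) 1 x₀ - ε ^ 2 * M ^ 2 / 4 ≤ c := by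
  set m := latticeVec k with hm
  set f := dirComp V m with hf
  have hfC : ContDiff ℝ 1 f := contDiff_dirComp hV m
  have hfper : IsLatticePeriodic f := isLatticePeriodic_dirComp hper m
  obtain ⟨φ, hφ, hφper, hφp⟩ := exists_corrector hfC hfper m one_ne_zero
  obtain ⟨u, hu, ⟨K, hK⟩, hsub, -⟩ := hc
  have hmpos : 0 < ‖m‖ ^ 2 := by positivity
  set v : EuclideanSpace ℝ (Fin n) → ℝ := fun x => u x + ε / 2 * φ x with hv
  have hvper : IsLatticePeriodic v := fun l x => by simp only [hv, hu l x, hφper l x]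
  have hvc : Continuous v := hK.continuous.add (continuous_const.mul hφ.continuous)
  obtain ⟨B, hB, hvB⟩ := hvper.exists_norm_le hvc
  -- the squared distance to the line through `x₀`, up to a factor
  set h : EuclideanSpace ℝ (Fin n) → ℝ :=
    fun x => ‖m‖ ^ 2 * ‖x - x₀‖ ^ 2 + -inner ℝ (x - x₀) m ^ 2 with hh
  have hhC : ContDiff ℝ 1 h :=
    (contDiff_const.mul ((contDiff_id.sub contDiff_const).norm_sq ℝ)).add
      (((contDiff_id.sub contDiff_const).inner ℝ contDiff_const).pow 2).neg
  have hh0 : ∀ x, 0 ≤ h x := fun x => by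
    have := abs_real_inner_le_norm (x - x₀) m
    have := sq_le_sq' (abs_le.1 this).1 (abs_le.1 this).2
    simp only [hh]
    nlinarith
  have hhx₀ : h x₀ = 0 := by simp [hh]
  have hhadd : ∀ x (t : ℝ), h (x + t • m) = h x := fun x t => by
    have e : x + t • m - x₀ = (x - x₀) + t • m := by abel
    simp only [hh]
    rw [e, norm_add_sq_real, inner_add_left, real_inner_smul_left, real_inner_smul_right,
      real_inner_self_eq_norm_sq, norm_smul, mul_pow, Real.norm_eq_abs, sq_abs]
    ring
  have hhg : ∀ x, inner ℝ (gradient h x) m = 0 := fun x => by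
    have h1 : HasDerivAt (fun t : ℝ => h (x + t • m)) (fderiv ℝ h x m) 0 := by
      have h2 : HasDerivAt (fun s : ℝ => x + s • m) m 0 := by
        simpa using ((hasDerivAt_id (0 : ℝ)).smul_const m).const_add x
      have h3 : HasFDerivAt h (fderiv ℝ h x) (x + (0 : ℝ) • m) := by
        simpa using (hhC.differentiable one_ne_zero x).hasFDerivAt
      exact h3.comp_hasDerivAt (0 : ℝ) h2
    rw [inner_gradient_left]
    refine h1.unique ?_
    simp only [hhadd]
    exact hasDerivAt_const _ _
  -- The penalty `A * h` pulls the touching point towards the line through `x₀`. Its gradient is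
  -- orthogonal to `m`, so it does not enter the linear terms.
  have key : ∀ A > 0, ∃ z : EuclideanSpace ℝ (Fin n), A * (‖m‖ ^ 2 * ‖z‖ ^ 2) ≤ 2 * B ∧
      ‖lam • m‖ ^ 2 + ε * lam * lineAvg f m 1 (x₀ + z) - ε ^ 2 * M ^ 2 / 4 ≤ c := by
    intro A hA
    -- Integer multiples of `m` preserve `v` and `h`; shifting by them confines the maximisation to
    -- a ball although `h` is constant along the line.
    have hred : ∀ x, ∃ x', v x' = v x ∧ h x' = h x ∧
        ‖m‖ ^ 2 * ‖x' - x₀‖ ^ 2 ≤ h x + (‖m‖ ^ 2) ^ 2 := by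
      intro x
      set j : ℤ := -⌊inner ℝ (x - x₀) m / ‖m‖ ^ 2⌋ with hj
      have hjm : (j : ℝ) • m = latticeVec (j • k) := by
        ext i
        simp [hm, latticeVec_apply]
      refine ⟨x + (j : ℝ) • m, ?_, hhadd _ _, ?_⟩
      · rw [hjm]; exact hvper _ x
      · have e : h (x + (j : ℝ) • m) = h x := hhadd _ _
        have hi : inner ℝ (x + (j : ℝ) • m - x₀) m =
            ‖m‖ ^ 2 * Int.fract (inner ℝ (x - x₀) m / ‖m‖ ^ 2) := by
          have e : x + (j : ℝ) • m - x₀ = (x - x₀) + (j : ℝ) • m := by abel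
          rw [e, inner_add_left, real_inner_smul_left, real_inner_self_eq_norm_sq, Int.fract, hj]
          push_cast
          field_simp
          ring
        have h1 := Int.fract_nonneg (inner ℝ (x - x₀) m / ‖m‖ ^ 2)
        have h2 := (Int.fract_lt_one (inner ℝ (x - x₀) m / ‖m‖ ^ 2)).le
        have h3 : inner ℝ (x + (j : ℝ) • m - x₀) m ^ 2 ≤ (‖m‖ ^ 2) ^ 2 := by
          rw [hi, mul_pow]
          have : Int.fract (inner ℝ (x - x₀) m / ‖m‖ ^ 2) ^ 2 ≤ 1 := pow_le_one₀ h1 h2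
          nlinarith [sq_nonneg (‖m‖ ^ 2)]
        rw [← e]
        simp only [hh]
        linarith
    set R := Real.sqrt ((2 * B / A + (‖m‖ ^ 2) ^ 2) / ‖m‖ ^ 2) with hR
    have hψc : Continuous fun x => v x - A * h x := hvc.sub (continuous_const.mul hhC.continuous)
    obtain ⟨y, -, hy⟩ := (isCompact_closedBall x₀ R).exists_isMaxOn
      ⟨x₀, mem_closedBall_self (Real.sqrt_nonneg _)⟩ hψc.continuousOn
    have hy0 := isMaxOn_iff.1 hy x₀ (mem_closedBall_self (Real.sqrt_nonneg _))
    have hglob : ∀ x, v x - A * h x ≤ v y - A * h y := by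
      intro x
      by_cases hx : A * h x ≤ 2 * B
      · obtain ⟨x', h1, h2, h3⟩ := hred x
        rw [← h1, ← h2]
        refine isMaxOn_iff.1 hy x' ?_
        rw [mem_closedBall, dist_eq_norm, hR]
        refine Real.le_sqrt_of_sq_le ?_
        rw [le_div_iff₀ hmpos]
        have : h x ≤ 2 * B / A := by rw [le_div_iff₀ hA]; linarith
        linarith
      · refine le_trans ?_ hy0
        have h1 := abs_le.1 (hvB x)
        have h2 := abs_le.1 (hvB x₀)
        rw [hhx₀]
        linarith [h1.2, h2.1]
    have hyB : A * h y ≤ 2 * B := by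
      have h1 := abs_le.1 (hvB y)
      have h2 := abs_le.1 (hvB x₀)
      rw [hhx₀] at hy0
      linarith [h1.2, h2.1]
    set g := (-(ε / 2)) • gradient φ y + A • gradient h y with hg
    have hgrad : HasGradientAt (fun x => (-(ε / 2)) * φ x + A * h x) g y :=
      ((hφ.hasGradientAt y).const_mul' _).add' ((hhC.hasGradientAt y).const_mul' _)
    have htest := hsub (fun x => (-(ε / 2)) * φ x + A * h x) y
      ((contDiff_const.mul hφ).add (contDiff_const.mul hhC))
      (Eventually.of_forall fun x => by
        have := hglob x
        simp only [hv] at this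
        simp only
        linarith)
    have hgm : inner ℝ g m = -(ε / 2) * (f y - lineAvg f m 1 y) := by
      rw [hg, inner_add_left, real_inner_smul_left, real_inner_smul_left, hφp, hhg]
      ring
    rw [hgrad.gradient, flowHamiltonian_add, real_inner_smul_right, real_inner_smul_right, hgm,
      real_inner_smul_left, real_inner_smul_left] at htest
    have hfy : inner ℝ (V y) m = f y := rfl
    rw [hfy] at htest
    -- Completing the square bounds the bracket from below for every `g`, so the size of `A` does no
    -- harm.
    have hsq : -(ε ^ 2 * M ^ 2 / 4) ≤ ‖g‖ ^ 2 + ε * inner ℝ (V y) g := by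
      have h1 := (abs_le.1 (abs_real_inner_le_norm (V y) g)).1
      have h2 : ‖V y‖ * ‖g‖ ≤ M * ‖g‖ := mul_le_mul_of_nonneg_right (hM y) (norm_nonneg _)
      have h3 : -(ε * (M * ‖g‖)) ≤ ε * inner ℝ (V y) g := by nlinarith
      nlinarith [sq_nonneg (‖g‖ - ε * M / 2)]
    -- Sliding `y` along `m` to the foot nearest `x₀` keeps both `h` and the line average.
    set t := inner ℝ (y - x₀) m / ‖m‖ ^ 2 with ht
    refine ⟨y - x₀ - t • m, ?_, ?_⟩
    · refine le_trans (le_of_eq ?_) hyB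
      have e1 : h y = h (y + (-t) • m) := (hhadd y (-t)).symm
      have e2 : y + (-t) • m - x₀ = y - x₀ - t • m := by module
      have e3 : inner ℝ (y - x₀ - t • m) m = 0 := by
        rw [inner_sub_left, real_inner_smul_left, real_inner_self_eq_norm_sq, ht]
        field_simp
        ring
      rw [e1]
      simp only [hh]
      rw [e2, e3]
      ring
    · have e1 : lineAvg f m 1 (x₀ + (y - x₀ - t • m)) = lineAvg f m 1 y := by
        have e2 : x₀ + (y - x₀ - t • m) = y + (-t) • m := by module
        rw [e2, hm, lineAvg_latticeVec_add_smul hfper]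
      rw [e1]
      nlinarith
  have hWc : Continuous fun z => ‖lam • m‖ ^ 2 + ε * lam * lineAvg f m 1 (x₀ + z)
      - ε ^ 2 * M ^ 2 / 4 := by
    have := continuous_lineAvg hfC.continuous m 1
    fun_prop
  refine le_of_forall_pos_le_add fun κ hκ => ?_
  obtain ⟨ρ, hρ, hWρ⟩ := Metric.continuous_iff.1 hWc 0 κ hκ
  obtain ⟨z, hz1, hz2⟩ := key ((2 * B + 1) / (‖m‖ ^ 2 * ρ ^ 2)) (by positivity)
  have hzρ : ‖z‖ < ρ := by
    refine lt_of_pow_lt_pow_left₀ 2 hρ.le ?_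
    have e : (2 * B + 1) / (‖m‖ ^ 2 * ρ ^ 2) * (‖m‖ ^ 2 * ‖z‖ ^ 2) =
        (2 * B + 1) * (‖z‖ ^ 2 / ρ ^ 2) := by field_simp
    rw [e] at hz1
    have : ‖z‖ ^ 2 / ρ ^ 2 < 1 := by
      by_contra hcon
      push Not at hcon
      nlinarith
    rwa [div_lt_one (by positivity)] at this
  have := abs_lt.1 (hWρ z (by rwa [dist_zero_right]))
  simp only [add_zero] at this
  linarith [this.1]

end Bounds

/-! ### The flat torus: Haar measure and Fourier series. -/

section Torus

variable {n : ℕ}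

/-- The covering map from Euclidean space to the flat torus. -/
def torusMk (x : EuclideanSpace ℝ (Fin n)) : UnitAddTorus (Fin n) :=
  fun i => (x i : UnitAddCircle)

theorem torusMk_add (x y : EuclideanSpace ℝ (Fin n)) :
    torusMk (x + y) = torusMk x + torusMk y := by
  ext i; simp [torusMk]

theorem isOpenQuotientMap_torusMk :
    IsOpenQuotientMap (torusMk : EuclideanSpace ℝ (Fin n) → UnitAddTorus (Fin n)) := by
  have h1 : IsOpenQuotientMap (Pi.map fun (_ : Fin n) (x : ℝ) => (x : UnitAddCircle)) :=
    IsOpenQuotientMap.piMap fun _ => QuotientAddGroup.isOpenQuotientMap_mk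
  exact h1.comp (EuclideanSpace.equiv (Fin n) ℝ).toHomeomorph.isOpenQuotientMap

theorem continuous_torusMk :
    Continuous (torusMk : EuclideanSpace ℝ (Fin n) → UnitAddTorus (Fin n)) :=
  isOpenQuotientMap_torusMk.continuous

theorem exists_latticeVec_of_torusMk_eq {x y : EuclideanSpace ℝ (Fin n)}
    (h : torusMk x = torusMk y) : ∃ k : Fin n → ℤ, y = x + latticeVec k := by
  have h1 : ∀ i, ∃ k : ℤ, y i = x i + k := fun i => by
    have h2 : (x i : UnitAddCircle) = (y i : UnitAddCircle) := congrFun h i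
    obtain ⟨k, hk⟩ := AddSubgroup.mem_zmultiples_iff.1 (QuotientAddGroup.eq.1 h2)
    refine ⟨k, ?_⟩
    rw [zsmul_eq_mul, mul_one] at hk
    linarith
  choose k hk using h1
  refine ⟨k, ?_⟩
  ext i
  simp [hk i, latticeVec_apply]

theorem torusMk_add_latticeVec (x : EuclideanSpace ℝ (Fin n)) (k : Fin n → ℤ) :
    torusMk (x + latticeVec k) = torusMk x := by
  ext i
  simp [torusMk, latticeVec_apply]

theorem isLatticePeriodic_comp_torusMk {F : Type*} (f : UnitAddTorus (Fin n) → F) :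
    IsLatticePeriodic fun x => f (torusMk x) := fun k x =>
  congrArg f (torusMk_add_latticeVec x k)

theorem IsLatticePeriodic.exists_torusLift {G : Type*} [TopologicalSpace G]
    {f : EuclideanSpace ℝ (Fin n) → G} (hf : IsLatticePeriodic f) (hc : Continuous f) :
    ∃ F : C(UnitAddTorus (Fin n), G), ∀ x, F (torusMk x) = f x := by
  have hq : Topology.IsQuotientMap (⟨torusMk, continuous_torusMk⟩ :
      C(EuclideanSpace ℝ (Fin n), UnitAddTorus (Fin n))) :=
    isOpenQuotientMap_torusMk.isQuotientMap
  have hfac : Function.FactorsThrough (⟨f, hc⟩ : C(EuclideanSpace ℝ (Fin n), G))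
      (⟨torusMk, continuous_torusMk⟩ :
        C(EuclideanSpace ℝ (Fin n), UnitAddTorus (Fin n))) := by
    intro x y hxy
    obtain ⟨k, rfl⟩ := exists_latticeVec_of_torusMk_eq hxy
    exact (hf k x).symm
  refine ⟨hq.lift _ hfac, fun x => ?_⟩
  exact congrArg (fun g : C(EuclideanSpace ℝ (Fin n), G) => g x) (hq.lift_comp _ hfac)

/-- The normalised Haar measure of the flat torus. -/
noncomputable def torusMeasure (n : ℕ) : Measure (UnitAddTorus (Fin n)) :=
  Measure.pi fun _ => AddCircle.haarAddCircle

instance : IsProbabilityMeasure (torusMeasure n) := by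
  unfold torusMeasure; infer_instance

instance : (torusMeasure n).IsAddHaarMeasure := by
  unfold torusMeasure; infer_instance

section Integral

variable {G : Type*} [NormedAddCommGroup G] [NormedSpace ℝ G]

theorem integral_torusMeasure (F : UnitAddTorus (Fin n) → G) :
    ∫ t, F t ∂torusMeasure n = ∫ x in unitCube n, F (torusMk x) := by
  have h1 : ∫ t, F t ∂torusMeasure n =
      ∫ x in {x : Fin n → ℝ | ∀ i, x i ∈ Ioc ((0 : Fin n → ℝ) i) ((0 : Fin n → ℝ) i + 1)},
        F (fun i => x i) := UnitAddTorus.integral_preimage F 0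
  have hset : {x : Fin n → ℝ | ∀ i, x i ∈ Ioc ((0 : Fin n → ℝ) i) ((0 : Fin n → ℝ) i + 1)} =
      univ.pi fun i => Ioc ((0 : Fin n → ℝ) i) ((1 : Fin n → ℝ) i) := by
    ext x; simp [Set.mem_pi]
  have hpre : unitCube n =
      (MeasurableEquiv.toLp 2 (Fin n → ℝ)).symm ⁻¹' (Icc (0 : Fin n → ℝ) 1) := by
    ext x
    simp [unitCube, Pi.le_def, forall_and]
  have hae : (univ.pi fun i => Ioc ((0 : Fin n → ℝ) i) ((1 : Fin n → ℝ) i)) =ᵐ[volume]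
      Icc (0 : Fin n → ℝ) 1 := Measure.univ_pi_Ioc_ae_eq_Icc
  rw [h1, hset, setIntegral_congr_set hae, hpre]
  exact ((EuclideanSpace.volume_preserving_symm_measurableEquiv_toLp (Fin n)).setIntegral_preimage_emb
    (MeasurableEquiv.measurableEmbedding _) (fun x => F (fun i => (x i : UnitAddCircle))) _).symm

/-- Fubini and translation invariance of Haar measure. -/
theorem integral_torusMeasure_intervalIntegral [CompleteSpace G] (F : C(UnitAddTorus (Fin n), G))
    (v : EuclideanSpace ℝ (Fin n)) :
    ∫ t, (∫ s in (0 : ℝ)..1, F (t + torusMk (s • v))) ∂torusMeasure n =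
      ∫ t, F t ∂torusMeasure n := by
  have hmk : Continuous fun s : ℝ => (torusMk (s • v) : UnitAddTorus (Fin n)) :=
    continuous_torusMk.comp (by fun_prop)
  have hc : Continuous (Function.uncurry fun (s : ℝ) (t : UnitAddTorus (Fin n)) =>
      F (t + torusMk (s • v))) :=
    F.continuous.comp (continuous_snd.add (hmk.comp continuous_fst))
  rw [← intervalIntegral_integral_swap]
  · simp_rw [integral_add_right_eq_self (μ := torusMeasure n) (fun t => F t)]
    simp
  · have : IsFiniteMeasure ((volume : Measure ℝ).restrict (uIoc 0 1)) := by
      rw [uIoc_of_le zero_le_one]; infer_instance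
    refine Integrable.of_bound hc.aestronglyMeasurable ‖F‖ (Eventually.of_forall fun z => ?_)
    exact F.norm_coe_le_norm _

/-- Averaging over translates does not change the mean of a periodic function. -/
theorem IsLatticePeriodic.setIntegral_intervalIntegral [CompleteSpace G]
    {f : EuclideanSpace ℝ (Fin n) → G} (hf : IsLatticePeriodic f) (hc : Continuous f) (v : EuclideanSpace ℝ (Fin n)) :
    ∫ x in unitCube n, (∫ s in (0 : ℝ)..1, f (x + s • v)) = ∫ x in unitCube n, f x := by
  obtain ⟨F, hF⟩ := hf.exists_torusLift hc
  have h := integral_torusMeasure_intervalIntegral F v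
  rw [integral_torusMeasure, integral_torusMeasure] at h
  simpa only [← torusMk_add, hF] using h

/-- A nonzero continuous periodic function of mean zero takes a positive value. -/
theorem IsLatticePeriodic.exists_pos_of_setIntegral_eq_zero {f : EuclideanSpace ℝ (Fin n) → ℝ}
    (hf : IsLatticePeriodic f) (hc : Continuous f) (hmean : ∫ x in unitCube n, f x = 0)
    (hne : ∃ x, f x ≠ 0) : ∃ x, 0 < f x := by
  by_contra! hcon
  obtain ⟨F, hF⟩ := hf.exists_torusLift hc
  have hnonneg : 0 ≤ fun t => -F t := fun t => by
    obtain ⟨x, rfl⟩ := isOpenQuotientMap_torusMk.surjective t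
    simpa [hF] using hcon x
  have hint : Integrable (fun t => -F t) (torusMeasure n) :=
    Integrable.of_bound F.continuous.neg.aestronglyMeasurable ‖F‖
      (Eventually.of_forall fun z => by rw [norm_neg]; exact F.norm_coe_le_norm _)
  have h0 : ∫ t, -F t ∂torusMeasure n = 0 := by
    rw [integral_neg, integral_torusMeasure]
    simp [hF, hmean]
  rw [integral_eq_zero_iff_of_nonneg hnonneg hint] at h0
  have h1 : (fun t => -F t) = 0 :=
    (Continuous.ae_eq_iff_eq _ F.continuous.neg continuous_zero).1 h0
  obtain ⟨x, hx⟩ := hne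
  have := congrFun h1 (torusMk x)
  simp only [hF, Pi.zero_apply, neg_eq_zero] at this
  exact hx this

end Integral

/-- The exponential monomials on Euclidean space. -/
noncomputable def expMonomial (k : Fin n → ℤ) (x : EuclideanSpace ℝ (Fin n)) : ℂ :=
  Complex.exp (2 * Real.pi * Complex.I * (inner ℝ (latticeVec k) x : ℝ))

theorem mFourier_torusMk (k : Fin n → ℤ) (x : EuclideanSpace ℝ (Fin n)) :
    UnitAddTorus.mFourier k (torusMk x) = expMonomial k x := by
  simp only [UnitAddTorus.mFourier, ContinuousMap.coe_mk, torusMk, fourier_coe_apply, expMonomial]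
  rw [← Complex.exp_sum, PiLp.inner_apply]
  congr 1
  push_cast
  rw [Finset.mul_sum]
  refine Finset.sum_congr rfl fun i _ => ?_
  simp [latticeVec_apply]
  ring

theorem continuous_expMonomial (k : Fin n → ℤ) : Continuous (expMonomial k) := by
  unfold expMonomial; fun_prop

theorem isLatticePeriodic_expMonomial (k : Fin n → ℤ) : IsLatticePeriodic (expMonomial k) := by
  have := isLatticePeriodic_comp_torusMk (fun t => UnitAddTorus.mFourier k t)
  simpa only [mFourier_torusMk] using this

theorem expMonomial_add_smul (k : Fin n → ℤ) (x v : EuclideanSpace ℝ (Fin n)) (s : ℝ) :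
    expMonomial k (x + s • v) =
      expMonomial k x * Complex.exp (2 * Real.pi * Complex.I * inner ℝ (latticeVec k) v * s) := by
  unfold expMonomial
  rw [← Complex.exp_add, inner_add_right, real_inner_smul_right]
  push_cast
  ring_nf

/-- A continuous periodic function with vanishing Fourier coefficients vanishes. -/
theorem IsLatticePeriodic.eq_zero_of_setIntegral_expMonomial {f : EuclideanSpace ℝ (Fin n) → ℂ}
    (hf : IsLatticePeriodic f) (hc : Continuous f)
    (h : ∀ k : Fin n → ℤ, ∫ x in unitCube n, expMonomial k x * f x = 0)
    (x : EuclideanSpace ℝ (Fin n)) : f x = 0 := by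
  obtain ⟨F, hF⟩ := hf.exists_torusLift hc
  have hcoeff : UnitAddTorus.mFourierCoeff (F : UnitAddTorus (Fin n) → ℂ) = 0 := by
    ext k
    have h1 : UnitAddTorus.mFourierCoeff (F : UnitAddTorus (Fin n) → ℂ) k =
        ∫ t, UnitAddTorus.mFourier (-k) t • F t ∂torusMeasure n := rfl
    rw [h1, integral_torusMeasure]
    simp only [hF, mFourier_torusMk, smul_eq_mul, h, Pi.zero_apply]
  have hs := UnitAddTorus.hasSum_mFourier_series_apply_of_summable (f := F)
    (by rw [hcoeff]; exact summable_zero) (torusMk x)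
  rw [hcoeff, hF] at hs
  simp only [Pi.zero_apply, zero_smul] at hs
  exact (hasSum_zero.unique hs).symm

end Torus

/-! ### Equidistribution in rationally independent directions. -/

section Weyl

variable {n : ℕ}

/-- A shift along `p` by half a period of the monomial multiplies it by `-1`, while Haar measure is
invariant. -/
theorem integral_mFourier_eq_zero {k : Fin n → ℤ} {p : EuclideanSpace ℝ (Fin n)}
    (hkp : inner ℝ (latticeVec k) p ≠ 0) :
    ∫ t, UnitAddTorus.mFourier k t ∂torusMeasure n = 0 := by
  have h1 := integral_add_right_eq_self (μ := torusMeasure n)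
    (fun t => UnitAddTorus.mFourier k t)
    (torusMk ((1 / (2 * inner ℝ (latticeVec k) p)) • p))
  have h2 : ∀ t : UnitAddTorus (Fin n), UnitAddTorus.mFourier k
      (t + torusMk ((1 / (2 * inner ℝ (latticeVec k) p)) • p)) =
      -UnitAddTorus.mFourier k t := by
    intro t
    obtain ⟨x, rfl⟩ := isOpenQuotientMap_torusMk.surjective t
    rw [← torusMk_add, mFourier_torusMk, mFourier_torusMk, expMonomial_add_smul]
    have : (2 * Real.pi * Complex.I * (inner ℝ (latticeVec k) p : ℝ) *
        ((1 / (2 * inner ℝ (latticeVec k) p) : ℝ) : ℂ)) = Real.pi * Complex.I := by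
      have : ((inner ℝ (latticeVec k) p : ℝ) : ℂ) ≠ 0 := Complex.ofReal_ne_zero.2 hkp
      push_cast
      field_simp
    rw [this, Complex.exp_pi_mul_I]
    ring
  simp only [h2, integral_neg] at h1
  exact self_eq_neg.1 h1.symm

/-- Weyl's equidistribution theorem for linear flows on the torus. -/
theorem eventually_norm_average_sub_le {p : EuclideanSpace ℝ (Fin n)}
    (hp : ∀ k : Fin n → ℤ, k ≠ 0 → inner ℝ (latticeVec k) p ≠ 0)
    (F : C(UnitAddTorus (Fin n), ℂ)) {δ : ℝ} (hδ : 0 < δ) :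
    ∀ᶠ T : ℝ in atTop, ∀ t,
      ‖(T⁻¹ : ℂ) * (∫ s in (0 : ℝ)..T, F (t + torusMk (s • p))) -
        ∫ t, F t ∂torusMeasure n‖ ≤ δ := by
  have hmk : Continuous fun s : ℝ => (torusMk (s • p) : UnitAddTorus (Fin n)) :=
    continuous_torusMk.comp (by fun_prop)
  have hcont : ∀ (G : C(UnitAddTorus (Fin n), ℂ)) t,
      Continuous fun s : ℝ => G (t + torusMk (s • p)) := fun G t =>
    G.continuous.comp (continuous_const.add hmk)
  have hint : ∀ (G : C(UnitAddTorus (Fin n), ℂ)) t (T : ℝ),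
      IntervalIntegrable (fun s : ℝ => G (t + torusMk (s • p))) volume 0 T := fun G t T =>
    (hcont G t).intervalIntegrable _ _
  have hmeas : ∀ G : C(UnitAddTorus (Fin n), ℂ), Integrable G (torusMeasure n) := fun G =>
    Integrable.of_bound G.continuous.aestronglyMeasurable ‖G‖
      (Eventually.of_forall fun z => G.norm_coe_le_norm _)
  set A : C(UnitAddTorus (Fin n), ℂ) → ℝ → UnitAddTorus (Fin n) → ℂ := fun G T t =>
    (T⁻¹ : ℂ) * (∫ s in (0 : ℝ)..T, G (t + torusMk (s • p))) - ∫ t, G t ∂torusMeasure n with hA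
  have hAadd : ∀ G H T t, A (G + H) T t = A G T t + A H T t := by
    intro G H T t
    simp only [hA, ContinuousMap.add_apply]
    rw [intervalIntegral.integral_add (hint G t T) (hint H t T),
      integral_add (hmeas G) (hmeas H)]
    ring
  have hAsmul : ∀ (c : ℂ) G T t, A (c • G) T t = c * A G T t := by
    intro c G T t
    simp only [hA, ContinuousMap.smul_apply, smul_eq_mul]
    rw [intervalIntegral.integral_const_mul, integral_const_mul]
    ring
  have hAnorm : ∀ G T t, 0 < T → ‖A G T t‖ ≤ 2 * ‖G‖ := by
    intro G T t hT
    have h1 : ‖∫ s in (0 : ℝ)..T, G (t + torusMk (s • p))‖ ≤ ‖G‖ * |T - 0| :=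
      intervalIntegral.norm_integral_le_of_norm_le_const fun s _ => G.norm_coe_le_norm _
    have h2 : ‖∫ t, G t ∂torusMeasure n‖ ≤ ‖G‖ := by
      have := norm_integral_le_of_norm_le_const (μ := torusMeasure n)
        (Eventually.of_forall fun z => G.norm_coe_le_norm z)
      simpa using this
    rw [sub_zero, abs_of_pos hT] at h1
    have h3 : ‖(T⁻¹ : ℂ)‖ = T⁻¹ := by
      rw [norm_inv, Complex.norm_real, Real.norm_of_nonneg hT.le]
    calc ‖A G T t‖ ≤ T⁻¹ * (‖G‖ * T) + ‖G‖ := by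
          refine (norm_sub_le _ _).trans (add_le_add ?_ h2)
          rw [norm_mul, h3]
          gcongr
      _ = 2 * ‖G‖ := by field_simp; ring
  -- The averaging error is linear in `G` and bounded by `2 * ‖G‖`, so trigonometric polynomials
  -- suffice by density.
  have hspan : ∀ G ∈ Submodule.span ℂ (range (UnitAddTorus.mFourier (d := Fin n))), ∀ δ > 0,
      ∀ᶠ T : ℝ in atTop, ∀ t, ‖A G T t‖ ≤ δ := by
    intro G hG
    induction hG using Submodule.span_induction with
    | zero =>
      intro δ hδ
      refine Eventually.of_forall fun T t => ?_
      simp [hA, hδ.le]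
    | add G H _ _ hG hH =>
      intro δ hδ
      filter_upwards [hG _ (half_pos hδ), hH _ (half_pos hδ)] with T h1 h2 t
      rw [hAadd]
      exact (norm_add_le _ _).trans (by linarith [h1 t, h2 t])
    | smul c G _ hG =>
      intro δ hδ
      filter_upwards [hG (δ / (‖c‖ + 1)) (by positivity)] with T h1 t
      rw [hAsmul, norm_mul]
      have h2 := h1 t
      rw [le_div_iff₀ (by positivity)] at h2
      nlinarith [norm_nonneg (A G T t), norm_nonneg c]
    | mem G hG =>
      obtain ⟨k, rfl⟩ := hG
      intro δ hδ
      by_cases hk : k = 0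
      · filter_upwards [eventually_gt_atTop 0] with T hT t
        have hT' : (T : ℂ) ≠ 0 := Complex.ofReal_ne_zero.2 hT.ne'
        simp [hA, hk, UnitAddTorus.mFourier_zero, hT', hδ.le]
      -- A nonconstant monomial restricts to an exponential of nonzero frequency, whose integral
      -- stays bounded as `T` grows.
      · set θ := inner ℝ (latticeVec k) p with hθ
        have hθ0 : θ ≠ 0 := hp k hk
        set a : ℂ := 2 * Real.pi * Complex.I * θ with ha
        have ha0 : a ≠ 0 := by
          simp [ha, hθ0, Real.pi_ne_zero]
        have hlim : Tendsto (fun T : ℝ => T⁻¹ * (2 / ‖a‖)) atTop (𝓝 0) := by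
          simpa using tendsto_inv_atTop_zero.mul_const (2 / ‖a‖)
        filter_upwards [eventually_gt_atTop 0, hlim.eventually (gt_mem_nhds hδ)] with T hT hTδ t
        obtain ⟨x, rfl⟩ := isOpenQuotientMap_torusMk.surjective t
        have hexp : ∀ s : ℝ, ‖Complex.exp (a * s)‖ = 1 := fun s => by
          rw [Complex.norm_exp]
          simp [ha]
        have h1 : ∫ s in (0 : ℝ)..T, UnitAddTorus.mFourier k (torusMk x + torusMk (s • p)) =
            expMonomial k x * ((Complex.exp (a * T) - Complex.exp (a * (0 : ℝ))) / a) := by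
          rw [← integral_exp_mul_complex ha0, ← intervalIntegral.integral_const_mul]
          refine intervalIntegral.integral_congr fun s _ => ?_
          beta_reduce
          rw [← torusMk_add, mFourier_torusMk, expMonomial_add_smul]
        have h2 : ‖expMonomial k x‖ ≤ 1 := by
          rw [← mFourier_torusMk]
          exact (ContinuousMap.norm_coe_le_norm _ _).trans UnitAddTorus.mFourier_norm.le
        have h3 : ‖(T⁻¹ : ℂ)‖ = T⁻¹ := by
          rw [norm_inv, Complex.norm_real, Real.norm_of_nonneg hT.le]
        have h4 : ‖Complex.exp (a * T) - Complex.exp (a * (0 : ℝ))‖ ≤ 2 := by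
          refine (norm_sub_le _ _).trans ?_
          rw [hexp, hexp]; norm_num
        simp only [hA]
        rw [integral_mFourier_eq_zero hθ0, sub_zero, h1, norm_mul, norm_mul, norm_div, h3]
        refine le_trans ?_ hTδ.le
        have : 0 < ‖a‖ := norm_pos_iff.2 ha0
        have h5 : ‖Complex.exp (a * T) - Complex.exp (a * (0 : ℝ))‖ / ‖a‖ ≤ 2 / ‖a‖ := by
          gcongr
        have h6 : 0 ≤ ‖Complex.exp (a * T) - Complex.exp (a * (0 : ℝ))‖ / ‖a‖ := by positivity
        have h7 : ‖expMonomial k x‖ * (‖Complex.exp (a * T) - Complex.exp (a * (0 : ℝ))‖ / ‖a‖) ≤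
            1 * (2 / ‖a‖) := mul_le_mul h2 h5 h6 zero_le_one
        rw [one_mul] at h7
        gcongr
  have hclos : F ∈ closure (Submodule.span ℂ
      (range (UnitAddTorus.mFourier (d := Fin n))) : Set C(UnitAddTorus (Fin n), ℂ)) := by
    rw [← Submodule.topologicalClosure_coe, UnitAddTorus.span_mFourier_closure_eq_top]
    trivial
  obtain ⟨G, hG, hFG⟩ := Metric.mem_closure_iff.1 hclos (δ / 4) (by positivity)
  filter_upwards [hspan G hG (δ / 2) (half_pos hδ), eventually_gt_atTop 0] with T h1 hT t
  have h2 : A F T t = A (F - G) T t + A G T t := by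
    rw [← hAadd, sub_add_cancel]
  have h3 := hAnorm (F - G) T t hT
  rw [dist_eq_norm] at hFG
  change ‖A F T t‖ ≤ δ
  rw [h2]
  exact (norm_add_le _ _).trans (by linarith [h1 t])

theorem exists_lineAvg_le {p : EuclideanSpace ℝ (Fin n)}
    (hp : ∀ k : Fin n → ℤ, k ≠ 0 → inner ℝ (latticeVec k) p ≠ 0)
    {f : EuclideanSpace ℝ (Fin n) → ℝ} (hf : IsLatticePeriodic f) (hc : Continuous f)
    (hmean : ∫ x in unitCube n, f x = 0) {δ : ℝ} (hδ : 0 < δ) :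
    ∃ T : ℝ, T ≠ 0 ∧ ∀ x, lineAvg f p T x ≤ δ := by
  obtain ⟨F, hF⟩ := IsLatticePeriodic.exists_torusLift (f := fun x => (f x : ℂ))
    (fun k x => congrArg _ (hf k x)) (Complex.continuous_ofReal.comp hc)
  obtain ⟨T, hT, hT0⟩ :=
    ((eventually_norm_average_sub_le hp F hδ).and (eventually_ne_atTop 0)).exists
  refine ⟨T, hT0, fun x => ?_⟩
  have h := hT (torusMk x)
  rw [integral_torusMeasure] at h
  simp only [← torusMk_add, hF] at h
  rw [integral_complex_ofReal, hmean, intervalIntegral.integral_ofReal] at h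
  have e : ((T⁻¹ : ℂ) * ((∫ s in (0 : ℝ)..T, f (x + s • p) : ℝ) : ℂ) - ((0 : ℝ) : ℂ)) =
      ((lineAvg f p T x : ℝ) : ℂ) := by
    simp [lineAvg]
  rw [e, Complex.norm_real] at h
  exact (le_abs_self _).trans h

/-- The coordinates are successive powers of a transcendental number, so an integer relation is a
vanishing integer polynomial. -/
theorem exists_rationally_independent (n : ℕ) : ∃ p : EuclideanSpace ℝ (Fin n),
    ∀ k : Fin n → ℤ, k ≠ 0 → inner ℝ (latticeVec k) p ≠ 0 := by
  have hθ : Transcendental ℤ (liouvilleNumber (2 : ℕ)) := transcendental_liouvilleNumber le_rfl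
  refine ⟨WithLp.toLp 2 fun i => liouvilleNumber (2 : ℕ) ^ (i : ℕ), fun k hk h => hk ?_⟩
  set P : Polynomial ℤ := ∑ i : Fin n, Polynomial.monomial (i : ℕ) (k i) with hP
  have hPz : P = 0 := by
    refine transcendental_iff.1 hθ P ?_
    rw [hP, map_sum, ← h, PiLp.inner_apply]
    refine Finset.sum_congr rfl fun i _ => ?_
    simp [Polynomial.aeval_monomial, latticeVec_apply, mul_comm]
  ext i
  have h1 := congrArg (fun Q : Polynomial ℤ => Q.coeff (i : ℕ)) hPz
  simp only [hP, Polynomial.finsetSum_coeff, Polynomial.coeff_monomial, Polynomial.coeff_zero]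
    at h1
  rw [Finset.sum_eq_single i (fun j _ hj => if_neg fun h => hj (Fin.ext h)) (by simp)] at h1
  simpa using h1

end Weyl

/-! ### Circulation of divergence free fields. -/

section DivergenceFree

variable {n : ℕ} {V : EuclideanSpace ℝ (Fin n) → EuclideanSpace ℝ (Fin n)}

theorem Continuous.integrableOn_unitCube {F : Type*} [NormedAddCommGroup F]
    {f : EuclideanSpace ℝ (Fin n) → F} (hf : Continuous f) : IntegrableOn f (unitCube n) :=
  hf.continuousOn.integrableOn_compact isCompact_unitCube

theorem setIntegral_dirComp (hV : Continuous V) (hmean : ∫ x in unitCube n, V x = 0)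
    (p : EuclideanSpace ℝ (Fin n)) : ∫ x in unitCube n, dirComp V p x = 0 := by
  have := integral_inner (𝕜 := ℝ) hV.integrableOn_unitCube p
  rw [hmean, inner_zero_right] at this
  simpa only [dirComp, real_inner_comm] using this

/-- The `k`-th Fourier coefficient, up to the sign of `k`, of the `j`-th component of `V`. -/
noncomputable def fieldCoeff (V : EuclideanSpace ℝ (Fin n) → EuclideanSpace ℝ (Fin n))
    (k : Fin n → ℤ) (j : Fin n) : ℂ :=
  ∫ x in unitCube n, expMonomial k x * (V x j : ℂ)

theorem setIntegral_expMonomial_mul_dirComp (hV : Continuous V) (k : Fin n → ℤ)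
    (p : EuclideanSpace ℝ (Fin n)) :
    ∫ x in unitCube n, expMonomial k x * (dirComp V p x : ℂ) =
      ∑ j, (p j : ℂ) * fieldCoeff V k j := by
  have he := continuous_expMonomial k
  simp only [fieldCoeff]
  simp_rw [← integral_const_mul]
  rw [← integral_finsetSum]
  · refine integral_congr_ae (Eventually.of_forall fun x => ?_)
    simp only [dirComp, PiLp.inner_apply, RCLike.inner_apply, conj_trivial, Complex.ofReal_sum,
      Complex.ofReal_mul, Finset.mul_sum]
    exact Finset.sum_congr rfl fun j _ => by ring
  · exact fun j _ => Continuous.integrableOn_unitCube (by fun_prop)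

/-- If the circulation of `V` along all closed lines in the direction `l` vanishes, then so do the
`l`-components of the Fourier coefficients with frequency orthogonal to `l`. -/
theorem sum_mul_fieldCoeff_eq_zero (hV : Continuous V) (hper : IsLatticePeriodic V)
    {k l : Fin n → ℤ} (hkl : inner ℝ (latticeVec k) (latticeVec l) = 0)
    (hl : ∀ x, lineAvg (dirComp V (latticeVec l)) (latticeVec l) 1 x = 0) :
    ∑ j, (l j : ℂ) * fieldCoeff V k j = 0 := by
  have he := continuous_expMonomial k
  have hd : Continuous (dirComp V (latticeVec l)) := by unfold dirComp; fun_prop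
  have h1 := setIntegral_expMonomial_mul_dirComp hV k (latticeVec l)
  have h2 := IsLatticePeriodic.setIntegral_intervalIntegral
    (f := fun x => expMonomial k x * (dirComp V (latticeVec l) x : ℂ))
    (fun m x => by
      have e1 := isLatticePeriodic_expMonomial k m x
      have e2 := isLatticePeriodic_dirComp hper (latticeVec l) m x
      beta_reduce
      rw [e1, e2]) (by fun_prop) (latticeVec l)
  rw [h1] at h2
  -- As `k` is orthogonal to `l`, the monomial is constant along the line and factors out of the
  -- circulation.
  have h3 : ∀ x, ∫ s in (0 : ℝ)..1, expMonomial k (x + s • latticeVec l) *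
      (dirComp V (latticeVec l) (x + s • latticeVec l) : ℂ) = 0 := by
    intro x
    have h4 := hl x
    simp only [lineAvg, inv_one, one_mul] at h4
    simp only [expMonomial_add_smul, hkl, Complex.ofReal_zero, mul_zero, zero_mul,
      Complex.exp_zero, mul_one]
    rw [intervalIntegral.integral_const_mul, intervalIntegral.integral_ofReal, h4]
    simp
  simp only [h3, integral_zero] at h2
  simpa only [latticeVec_apply, Complex.ofReal_intCast] using h2.symm

theorem latticeVec_single (j : Fin n) :
    latticeVec (Pi.single j 1) = EuclideanSpace.single j (1 : ℝ) := by
  ext i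
  by_cases h : i = j <;> simp [latticeVec_apply, h]

/-- The Fourier coefficients of a divergence free field are orthogonal to the frequency. -/
theorem sum_freq_mul_fieldCoeff_eq_zero (hV : ContDiff ℝ 1 V) (hper : IsLatticePeriodic V)
    (hdiv : ∀ x, vectorDivergence V x = 0) (k : Fin n → ℤ) :
    ∑ j, (k j : ℂ) * fieldCoeff V k j = 0 := by
  have he := continuous_expMonomial k
  have hVc := hV.continuous
  have hfd := hV.continuous_fderiv one_ne_zero
  set a : ℂ := 2 * Real.pi * Complex.I with ha
  have ha0 : a ≠ 0 := by simp [ha, Real.pi_ne_zero]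
  -- `D j` is the `j`-th partial derivative of the monomial times `V j`. It integrates to zero over
  -- a period, and the sum over `j` removes the divergence.
  set D : Fin n → EuclideanSpace ℝ (Fin n) → ℂ := fun j x =>
    expMonomial k x * ((fderiv ℝ V x (EuclideanSpace.single j (1 : ℝ)) j : ℝ) : ℂ) +
      a * k j * (expMonomial k x * (V x j : ℂ)) with hD
  have hDc : ∀ j, Continuous (D j) := fun j => by
    simp only [hD]
    have : Continuous fun x => fderiv ℝ V x (EuclideanSpace.single j (1 : ℝ)) := by fun_prop
    fun_prop
  have hDper : ∀ j, IsLatticePeriodic (D j) := fun j m x => by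
    have e1 := isLatticePeriodic_expMonomial k m x
    have e2 := hper m x
    have e3 := hper.fderiv m x
    simp only [hD, e1, e2, e3]
  have hder : ∀ j x (s : ℝ), HasDerivAt (fun s : ℝ =>
      expMonomial k (x + s • EuclideanSpace.single j (1 : ℝ)) *
        (V (x + s • EuclideanSpace.single j (1 : ℝ)) j : ℂ))
      (D j (x + s • EuclideanSpace.single j (1 : ℝ))) s := by
    intro j x s
    set v := EuclideanSpace.single j (1 : ℝ) with hv
    have hkv : inner ℝ (latticeVec k) v = (k j : ℝ) := by
      rw [hv, EuclideanSpace.inner_single_right]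
      simp [latticeVec_apply]
    have h1 : HasDerivAt (fun s : ℝ => expMonomial k (x + s • v))
        (a * k j * expMonomial k (x + s • v)) s := by
      simp only [expMonomial_add_smul, hkv]
      have h2 : HasDerivAt (fun s : ℝ => 2 * Real.pi * Complex.I * ((k j : ℝ) : ℂ) * (s : ℂ))
          (2 * Real.pi * Complex.I * ((k j : ℝ) : ℂ)) s := by
        simpa using (Complex.ofRealCLM.hasDerivAt (x := s)).const_mul
          (2 * Real.pi * Complex.I * ((k j : ℝ) : ℂ))
      refine (h2.cexp.const_mul (expMonomial k x)).congr_deriv ?_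
      rw [ha, Complex.ofReal_intCast]
      ring
    have h3 : HasDerivAt (fun s : ℝ => (V (x + s • v) j : ℂ))
        ((fderiv ℝ V (x + s • v) v j : ℝ) : ℂ) s := by
      have h4 : HasDerivAt (fun s : ℝ => x + s • v) v s := by
        simpa using ((hasDerivAt_id s).smul_const v).const_add x
      have h5 : HasFDerivAt V (fderiv ℝ V (x + s • v)) (x + s • v) :=
        (hV.differentiable one_ne_zero _).hasFDerivAt
      have h6 := h5.comp_hasDerivAt s h4
      have h7 : HasDerivAt (fun s : ℝ => V (x + s • v) j) (fderiv ℝ V (x + s • v) v j) s :=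
        (EuclideanSpace.proj (𝕜 := ℝ) j).hasFDerivAt.comp_hasDerivAt s h6
      exact h7.ofReal_comp
    refine (h1.mul h3).congr_deriv ?_
    simp only [hD]
    ring
  have hzero : ∀ j, ∫ x in unitCube n, D j x = 0 := by
    intro j
    rw [← (hDper j).setIntegral_intervalIntegral (hDc j) (EuclideanSpace.single j (1 : ℝ))]
    have : ∀ x, ∫ s in (0 : ℝ)..1, D j (x + s • EuclideanSpace.single j (1 : ℝ)) = 0 := by
      intro x
      rw [intervalIntegral.integral_eq_sub_of_hasDerivAt (fun s _ => hder j x s)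
        (Continuous.intervalIntegrable ((hDc j).comp (by fun_prop)) _ _)]
      have e1 := isLatticePeriodic_expMonomial k (Pi.single j 1) x
      have e2 := hper (Pi.single j 1) x
      change expMonomial k (x + latticeVec _) = _ at e1
      change V (x + latticeVec _) = _ at e2
      rw [latticeVec_single] at e1 e2
      simp [e1, e2]
    simp only [this, integral_zero]
  have hsum : ∀ x, ∑ j, D j x = ∑ j, a * k j * (expMonomial k x * (V x j : ℂ)) := by
    intro x
    simp only [hD]
    rw [Finset.sum_add_distrib, ← Finset.mul_sum, ← Complex.ofReal_sum]
    have := hdiv x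
    simp only [vectorDivergence] at this
    rw [this]
    simp
  have hfin : ∫ x in unitCube n, ∑ j, D j x = a * ∑ j, (k j : ℂ) * fieldCoeff V k j := by
    simp only [hsum]
    rw [integral_finsetSum _ fun j _ => Continuous.integrableOn_unitCube (by fun_prop),
      Finset.mul_sum]
    refine Finset.sum_congr rfl fun j _ => ?_
    rw [integral_const_mul, fieldCoeff, mul_assoc]
  rw [integral_finsetSum _ fun j _ => (hDc j).integrableOn_unitCube] at hfin
  simp only [hzero, Finset.sum_const_zero] at hfin
  exact (mul_eq_zero.1 hfin.symm).resolve_left ha0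

/-- A nonzero divergence free field of mean zero has nonzero circulation along some closed line. -/
theorem exists_lineAvg_ne_zero (hV : ContDiff ℝ 1 V) (hper : IsLatticePeriodic V)
    (hdiv : ∀ x, vectorDivergence V x = 0) (hmean : ∫ x in unitCube n, V x = 0)
    (hne : ∃ x, V x ≠ 0) :
    ∃ (k : Fin n → ℤ) (x : EuclideanSpace ℝ (Fin n)),
      lineAvg (dirComp V (latticeVec k)) (latticeVec k) 1 x ≠ 0 := by
  by_contra! hcon
  obtain ⟨x, hx⟩ := hne
  refine hx ?_
  ext j
  have hVj : Continuous fun x => (V x j : ℂ) := by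
    have := hV.continuous
    fun_prop
  suffices h : ∀ k, fieldCoeff V k j = 0 by
    have := IsLatticePeriodic.eq_zero_of_setIntegral_expMonomial (f := fun x => (V x j : ℂ))
      (fun m x => by
        beta_reduce
        rw [hper m x]) hVj h x
    exact Complex.ofReal_eq_zero.1 this
  intro k
  -- The vector `k i • e_j - k j • e_i` is orthogonal to `k`, so vanishing circulation along it
  -- makes the coefficient parallel to `k`.
  have hcross : ∀ i, (k i : ℂ) * fieldCoeff V k j = k j * fieldCoeff V k i := by
    intro i
    have h1 : inner ℝ (latticeVec k) (latticeVec (Pi.single j (k i) - Pi.single i (k j))) = 0 := by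
      rw [PiLp.inner_apply]
      simp [latticeVec_apply, Pi.single_apply, sub_mul]
      ring
    have h2 := sum_mul_fieldCoeff_eq_zero hV.continuous hper h1 (hcon _)
    simp [Pi.single_apply, sub_mul] at h2
    exact sub_eq_zero.1 h2
  by_cases hk : k = 0
  · have h1 := setIntegral_dirComp hV.continuous hmean (EuclideanSpace.single j (1 : ℝ))
    simp only [fieldCoeff, hk, expMonomial]
    have h2 : ∀ x, dirComp V (EuclideanSpace.single j (1 : ℝ)) x = V x j := fun x => by
      simp [dirComp, EuclideanSpace.inner_single_right]
    simp only [h2] at h1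
    have h3 : latticeVec (0 : Fin n → ℤ) = 0 := by ext i; simp [latticeVec_apply]
    simp [h3, integral_complex_ofReal, h1]
  · have h1 : (∑ i, (k i : ℂ) ^ 2) * fieldCoeff V k j = 0 := by
      rw [Finset.sum_mul]
      have h2 : ∀ i, (k i : ℂ) ^ 2 * fieldCoeff V k j = k j * (k i * fieldCoeff V k i) := by
        intro i
        rw [sq, mul_assoc, hcross i]
        ring
      simp only [h2]
      rw [← Finset.mul_sum, sum_freq_mul_fieldCoeff_eq_zero hV hper hdiv, mul_zero]
    refine (mul_eq_zero.1 h1).resolve_left fun h => hk ?_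
    have h3 : ∑ i, k i ^ 2 = 0 := by exact_mod_cast h
    ext i
    have h4 := (Finset.sum_eq_zero_iff_of_nonneg fun i _ => sq_nonneg (k i)).1 h3 i
      (Finset.mem_univ i)
    simpa using h4

theorem setIntegral_lineAvg (hV : Continuous V) (hper : IsLatticePeriodic V)
    (hmean : ∫ x in unitCube n, V x = 0) (p : EuclideanSpace ℝ (Fin n)) :
    ∫ x in unitCube n, lineAvg (dirComp V p) p 1 x = 0 := by
  have hd : Continuous (dirComp V p) := by unfold dirComp; fun_prop
  simp only [lineAvg, inv_one, one_mul]
  rw [(isLatticePeriodic_dirComp hper p).setIntegral_intervalIntegral hd,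
    setIntegral_dirComp hV hmean]

theorem isLatticePeriodic_lineAvg {f : EuclideanSpace ℝ (Fin n) → ℝ} (hf : IsLatticePeriodic f)
    (p : EuclideanSpace ℝ (Fin n)) (T : ℝ) : IsLatticePeriodic (lineAvg f p T) := by
  intro k x
  refine congrArg (fun y => T⁻¹ * y) (intervalIntegral.integral_congr fun s _ => ?_)
  beta_reduce
  rw [add_right_comm, hf k]

theorem exists_lineAvg_pos (hV : ContDiff ℝ 1 V) (hper : IsLatticePeriodic V)
    (hmean : ∫ x in unitCube n, V x = 0) {k : Fin n → ℤ}
    (hk : ∃ x, lineAvg (dirComp V (latticeVec k)) (latticeVec k) 1 x ≠ 0) :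
    ∃ x, 0 < lineAvg (dirComp V (latticeVec k)) (latticeVec k) 1 x :=
  (isLatticePeriodic_lineAvg (isLatticePeriodic_dirComp hper _) _ _).exists_pos_of_setIntegral_eq_zero
    (continuous_lineAvg (contDiff_dirComp hV _).continuous _ _)
    (setIntegral_lineAvg hV.continuous hper hmean _) hk

theorem latticeVec_neg (k : Fin n → ℤ) : latticeVec (-k) = -latticeVec k := by
  ext i; simp [latticeVec_apply]

/-- The segment is traversed backwards from its endpoint, which turns nonzero circulation for `k`
into nonzero circulation for `-k`. -/
theorem lineAvg_dirComp_neg (p x : EuclideanSpace ℝ (Fin n)) :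
    lineAvg (dirComp V (-p)) (-p) 1 (x + p) = -lineAvg (dirComp V p) p 1 x := by
  have h := intervalIntegral.integral_comp_sub_left (a := 0) (b := 1)
    (fun s : ℝ => dirComp V p (x + s • p)) 1
  simp only [sub_self, sub_zero] at h
  simp only [lineAvg, inv_one, one_mul, ← h]
  rw [← intervalIntegral.integral_neg]
  refine intervalIntegral.integral_congr fun s _ => ?_
  simp only [dirComp, inner_neg_right]
  congr 3
  module

end DivergenceFree

/-! ### The burning velocity and the sphere obstruction. -/

section BurningVelocity

variable {n : ℕ} {b : EuclideanSpace ℝ (Fin n) → EuclideanSpace ℝ (Fin n)}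
  {p : EuclideanSpace ℝ (Fin n)}

theorem burningVelocity_smul (b : EuclideanSpace ℝ (Fin n) → EuclideanSpace ℝ (Fin n))
    (p : EuclideanSpace ℝ (Fin n)) {t : ℝ} (ht : 0 < t) :
    burningVelocity b (t • p) = t * burningVelocity b p := by
  unfold burningVelocity
  rw [Real.mul_iInf_of_nonneg ht.le]
  refine Function.Surjective.iInf_congr
    (fun l : Ioi (0 : ℝ) => (⟨l * t, mul_pos l.2 ht⟩ : Ioi (0 : ℝ))) (fun l => ?_) fun l => ?_
  · exact ⟨⟨l / t, div_pos l.2 ht⟩, Subtype.ext (div_mul_cancel₀ _ ht.ne')⟩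
  · have : (l : ℝ) ≠ 0 := (mem_Ioi.1 l.2).ne'
    simp only [smul_smul]
    field_simp

theorem le_burningVelocity {a : ℝ}
    (h : ∀ l > 0, a * l ≤ 1 + effectiveHamiltonian b (l • p)) : a ≤ burningVelocity b p := by
  have : Nonempty (Ioi (0 : ℝ)) := ⟨⟨1, mem_Ioi.2 one_pos⟩⟩
  exact le_ciInf fun l => (le_div_iff₀ l.2).2 (h l l.2)

/-- The choice `l = 1`, which for unit `p` is optimal when there is no flow. A real infimum needs a
lower bound for the family, here `-M * ‖p‖`. -/
theorem burningVelocity_le (hb : Continuous b) (hper : IsLatticePeriodic b) :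
    burningVelocity b p ≤ 1 + effectiveHamiltonian b p := by
  obtain ⟨M, hM, hbM⟩ := hper.exists_norm_le hb
  have hbdd : BddBelow (range fun l : Ioi (0 : ℝ) =>
      (1 + effectiveHamiltonian b ((l : ℝ) • p)) / (l : ℝ)) := by
    refine ⟨-(M * ‖p‖), ?_⟩
    rintro _ ⟨l, rfl⟩
    have hl : 0 < (l : ℝ) := l.2
    have h := (isErgodicConstant_effectiveHamiltonian hb hper ((l : ℝ) • p)).sq_sub_le hbM
    rw [norm_smul, Real.norm_of_nonneg hl.le] at h
    simp only
    rw [le_div_iff₀ hl]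
    nlinarith [sq_nonneg ((l : ℝ) * ‖p‖)]
  simpa [burningVelocity] using ciInf_le hbdd ⟨1, mem_Ioi.2 one_pos⟩

theorem two_sub_le_burningVelocity (hb : Continuous b) (hper : IsLatticePeriodic b) {M : ℝ}
    (hM : ∀ x, ‖b x‖ ≤ M) (hp : ‖p‖ = 1) : 2 - M ≤ burningVelocity b p := by
  refine le_burningVelocity fun l hl => ?_
  have h := (isErgodicConstant_effectiveHamiltonian hb hper (l • p)).sq_sub_le hM
  rw [norm_smul, Real.norm_of_nonneg hl.le, hp, mul_one] at h
  nlinarith [sq_nonneg (l - 1)]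

/-- Vieta's formula for the two intersections of a line through the origin with a sphere. -/
theorem burningVelocity_mul_neg_of_eq_sphere {z e : EuclideanSpace ℝ (Fin n)} {r : ℝ}
    (h : {p | burningVelocity b p = 1} = sphere z r) (he : ‖e‖ = 1)
    (h1 : 0 < burningVelocity b e) (h2 : 0 < burningVelocity b (-e)) :
    burningVelocity b e * burningVelocity b (-e) * (r ^ 2 - ‖z‖ ^ 2) = 1 := by
  -- By homogeneity the ray of `v` meets the level set at `v / α(v)`; substituting this in the
  -- sphere equation gives a quadratic for `α(v)`.
  have key : ∀ v : EuclideanSpace ℝ (Fin n), ‖v‖ = 1 → 0 < burningVelocity b v →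
      1 - 2 * burningVelocity b v * inner ℝ v z +
        burningVelocity b v ^ 2 * (‖z‖ ^ 2 - r ^ 2) = 0 := by
    intro v hv hpos
    have hmem : (burningVelocity b v)⁻¹ • v ∈ sphere z r := by
      rw [← h, mem_ofPred_eq, burningVelocity_smul _ _ (inv_pos.2 hpos), inv_mul_cancel₀ hpos.ne']
    rw [mem_sphere, dist_eq_norm] at hmem
    have h3 : ‖(burningVelocity b v)⁻¹ • v - z‖ ^ 2 = r ^ 2 := by rw [hmem]
    rw [norm_sub_sq_real, norm_smul, hv, real_inner_smul_left, mul_one, Real.norm_eq_abs,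
      sq_abs] at h3
    field_simp at h3
    linarith
  have k1 := key e he h1
  have k2 := key (-e) (by rwa [norm_neg]) h2
  rw [inner_neg_left] at k2
  set α := burningVelocity b e
  set β := burningVelocity b (-e)
  -- This combination eliminates `⟨e, z⟩`, hence the dependence on the centre's direction.
  have h3 : (α + β) * (α * β * (r ^ 2 - ‖z‖ ^ 2) - 1) = 0 := by
    linear_combination (-β) * k1 - α * k2
  have h4 := (mul_eq_zero.1 h3).resolve_left (by positivity)
  linarith

end BurningVelocity

/-! ### Burning velocity of a small flow. -/

section SmallFlow

variable {n : ℕ} {V : EuclideanSpace ℝ (Fin n) → EuclideanSpace ℝ (Fin n)}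

theorem IsLatticePeriodic.const_smul_field (hper : IsLatticePeriodic V) (ε : ℝ) :
    IsLatticePeriodic fun x => ε • V x := fun k x => congrArg _ (hper k x)

theorem exists_burningVelocity_le (hV : ContDiff ℝ 1 V) (hper : IsLatticePeriodic V)
    (hmean : ∫ x in unitCube n, V x = 0) {e : EuclideanSpace ℝ (Fin n)} (he : ‖e‖ = 1)
    (hind : ∀ k : Fin n → ℤ, k ≠ 0 → inner ℝ (latticeVec k) e ≠ 0) {δ : ℝ} (hδ : 0 < δ) :
    ∃ C, 0 ≤ C ∧ ∀ ε > 0,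
      burningVelocity (fun x => ε • V x) e ≤ 2 + ε * δ + C * ε ^ 2 := by
  obtain ⟨T, hT, hTδ⟩ := exists_lineAvg_le hind (isLatticePeriodic_dirComp hper e)
    (contDiff_dirComp hV e).continuous (setIntegral_dirComp hV.continuous hmean e) hδ
  obtain ⟨C, hC, h⟩ := exists_ergodicConstant_le hV hper e hT hTδ
  refine ⟨C, hC, fun ε hε => ?_⟩
  have hc : Continuous fun x => ε • V x := hV.continuous.const_smul ε
  have h1 := h ε hε _ (isErgodicConstant_effectiveHamiltonian hc (hper.const_smul_field ε) e)
  rw [he] at h1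
  have h2 := burningVelocity_le (p := e) hc (hper.const_smul_field ε)
  linarith

theorem le_burningVelocity_of_lineAvg (hV : ContDiff ℝ 1 V) (hper : IsLatticePeriodic V) {M : ℝ}
    (hM : ∀ x, ‖V x‖ ≤ M) {k : Fin n → ℤ} (hk : latticeVec k ≠ 0) {ε : ℝ} (hε : 0 < ε)
    (hεM : ε ^ 2 * M ^ 2 / 4 ≤ 1) (x₀ : EuclideanSpace ℝ (Fin n)) :
    2 + ε * (lineAvg (dirComp V (latticeVec k)) (latticeVec k) 1 x₀ / ‖latticeVec k‖) -
      ε ^ 2 * M ^ 2 / 2 ≤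
      burningVelocity (fun x => ε • V x) (‖latticeVec k‖⁻¹ • latticeVec k) := by
  refine le_burningVelocity fun l hl => ?_
  have hc : Continuous fun x => ε • V x := hV.continuous.const_smul ε
  have hm : 0 < ‖latticeVec k‖ := norm_pos_iff.2 hk
  have h := le_ergodicConstant hV hper hM hk (lam := l * ‖latticeVec k‖⁻¹) hε
    (isErgodicConstant_effectiveHamiltonian hc (hper.const_smul_field ε) _) x₀
  have hn : ‖(l * ‖latticeVec k‖⁻¹) • latticeVec k‖ = l := by
    rw [norm_smul, Real.norm_of_nonneg (by positivity)]
    field_simp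
  rw [hn] at h
  rw [smul_smul]
  refine le_trans ?_ (add_le_add le_rfl h)
  set w := lineAvg (dirComp V (latticeVec k)) (latticeVec k) 1 x₀
  have e1 : ε * (l * ‖latticeVec k‖⁻¹) * w = ε * (w / ‖latticeVec k‖) * l := by
    field_simp
  rw [e1]
  set τ := ε ^ 2 * M ^ 2 / 4 with hτ
  have hτ0 : 0 ≤ τ := by positivity
  have e2 : ε ^ 2 * M ^ 2 / 2 = 2 * τ := by rw [hτ]; ring
  rw [e2]
  -- `l² + 1 - τ - 2 (1 - τ) l = (l - (1 - τ))² + τ (1 - τ)`.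
  nlinarith [sq_nonneg (l - (1 - τ)), mul_nonneg hτ0 (sub_nonneg.2 hεM)]

end SmallFlow

/-! ### Comparison of resonant and nonresonant directions. -/

theorem theorem1p1 (n : ℕ) (V : EuclideanSpace ℝ (Fin n) → EuclideanSpace ℝ (Fin n))
    (hsmooth : ContDiff ℝ ∞ V) (hper : IsLatticePeriodic V)
    (hdiv : ∀ x, vectorDivergence V x = 0)
    (hmean : ∫ x in unitCube n, V x = 0)
    (hV : ∃ x, V x ≠ 0) :
    ∃ ε₀ : ℝ, 0 < ε₀ ∧ ∀ ε ∈ Set.Ioo (0 : ℝ) ε₀,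
      -- the effective Hamiltonian of the flow `ε V` is well defined
      (∀ p : EuclideanSpace ℝ (Fin n), ∃! c : ℝ, IsErgodicConstant (fun x => ε • V x) p c) ∧
      -- the unit level set is not a round sphere, whatever its centre and radius
      (¬ ∃ (z : EuclideanSpace ℝ (Fin n)) (r : ℝ),
        {p | burningVelocity (fun x => ε • V x) p = 1} = Metric.sphere z r) ∧
      -- the effective burning velocity is not a multiple of the Euclidean norm
      (¬ ∃ b : ℝ, ∀ p : EuclideanSpace ℝ (Fin n),
        burningVelocity (fun x => ε • V x) p = b * ‖p‖) := by
  have hV1 : ContDiff ℝ 1 V := hsmooth.of_le (by norm_cast)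
  obtain ⟨M, hM, hVM⟩ := hper.exists_norm_le hV1.continuous
  -- a resonant direction
  obtain ⟨k, y, hky⟩ := exists_lineAvg_ne_zero hV1 hper hdiv hmean hV
  set m := latticeVec k with hm
  have hm0 : m ≠ 0 := fun h => hky (by simp [h, lineAvg, dirComp])
  have hmpos : 0 < ‖m‖ := norm_pos_iff.2 hm0
  have hneg : latticeVec (-k) = -m := latticeVec_neg k
  obtain ⟨x₁, hx₁⟩ := exists_lineAvg_pos hV1 hper hmean ⟨y, hky⟩
  obtain ⟨x₂, hx₂⟩ := exists_lineAvg_pos hV1 hper hmean (k := -k)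
    ⟨y + m, by rw [hneg, lineAvg_dirComp_neg]; exact neg_ne_zero.2 hky⟩
  rw [← hm] at hx₁
  rw [hneg] at hx₂
  set w := min (lineAvg (dirComp V m) m 1 x₁ / ‖m‖) (lineAvg (dirComp V (-m)) (-m) 1 x₂ / ‖m‖)
    with hw
  have hwpos : 0 < w := lt_min (by positivity) (by positivity)
  -- a rationally independent direction
  obtain ⟨p, hp⟩ := exists_rationally_independent n
  have hk0 : k ≠ 0 := by
    rintro rfl
    exact hm0 (by ext i; simp [hm, latticeVec_apply])
  have hp0 : p ≠ 0 := fun h => hp k hk0 (by simp [h])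
  set e := ‖p‖⁻¹ • p with he
  have hen : ‖e‖ = 1 := norm_smul_inv_norm hp0
  have hei : ∀ k : Fin n → ℤ, k ≠ 0 → inner ℝ (latticeVec k) e ≠ 0 := fun k hk => by
    rw [he, real_inner_smul_right]
    exact mul_ne_zero (inv_ne_zero (norm_ne_zero_iff.2 hp0)) (hp k hk)
  have hei' : ∀ k : Fin n → ℤ, k ≠ 0 → inner ℝ (latticeVec k) (-e) ≠ 0 := fun k hk => by
    rw [inner_neg_right]
    exact neg_ne_zero.2 (hei k hk)
  obtain ⟨C₁, hC₁, hup₁⟩ :=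
    exists_burningVelocity_le hV1 hper hmean hen hei (δ := w / 8) (by positivity)
  obtain ⟨C₂, hC₂, hup₂⟩ := exists_burningVelocity_le hV1 hper hmean
    (e := -e) (by rwa [norm_neg]) hei' (δ := w / 8) (by positivity)
  set N := 8 * (C₁ + C₂) + M ^ 2 with hN
  have hN0 : 0 ≤ N := by positivity
  -- The first bound gives `C ε² ≤ εw/8` for both upper constants and `ε² M² / 2 ≤ εw/2`. The second
  -- gives `εM < 1`, hence positivity of the burning velocity and the smallness required in the
  -- lower bound.
  refine ⟨min (w / (N + 1)) (1 / (M + 1)), by positivity, fun ε hε => ?_⟩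
  have hε0 : 0 < ε := hε.1
  have hεN : ε * (N + 1) < w := by
    rw [← lt_div_iff₀ (by positivity)]
    exact hε.2.trans_le (min_le_left _ _)
  have hεM : ε * M < 1 := by
    have h1 := hε.2.trans_le (min_le_right _ _)
    rw [lt_div_iff₀ (by positivity)] at h1
    linarith
  have hεsq : ε ^ 2 * M ^ 2 / 4 ≤ 1 := by
    have : (ε * M) ^ 2 ≤ 1 := pow_le_one₀ (by positivity) hεM.le
    rw [mul_pow] at this
    linarith
  have hεper := hper.const_smul_field ε
  have hεC : ContDiff ℝ 1 fun x => ε • V x := hV1.const_smul ε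
  set α := burningVelocity fun x => ε • V x with hα
  set u := ‖m‖⁻¹ • m with hu
  have hun : ‖u‖ = 1 := norm_smul_inv_norm hm0
  have hεbd : ∀ x, ‖ε • V x‖ ≤ ε * M := fun x => by
    rw [norm_smul, Real.norm_of_nonneg hε0.le]
    exact mul_le_mul_of_nonneg_left (hVM x) hε0.le
  have hpos : ∀ v : EuclideanSpace ℝ (Fin n), ‖v‖ = 1 → 0 < α v := fun v hv => by
    have := two_sub_le_burningVelocity hεC.continuous hεper hεbd hv
    rw [← hα] at this
    linarith
  have hsmall : ∀ C, 0 ≤ C → 8 * C ≤ N → 2 + ε * (w / 8) + C * ε ^ 2 ≤ 2 + ε * w / 4 := by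
    intro C hC hCN
    have h1 : 8 * C * ε ≤ w := by nlinarith
    nlinarith
  have he₁ : α e ≤ 2 + ε * w / 4 := (hup₁ ε hε0).trans (hsmall C₁ hC₁ (by nlinarith [sq_nonneg M]))
  have he₂ : α (-e) ≤ 2 + ε * w / 4 :=
    (hup₂ ε hε0).trans (hsmall C₂ hC₂ (by nlinarith [sq_nonneg M]))
  have hlarge : ∀ W, w ≤ W → 2 + ε * w / 2 ≤ 2 + ε * W - ε ^ 2 * M ^ 2 / 2 := by
    intro W hW
    have h1 : ε * M ^ 2 ≤ w := by nlinarith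
    nlinarith
  have hu₁ : 2 + ε * w / 2 ≤ α u :=
    (hlarge _ (min_le_left _ _)).trans
      (le_burningVelocity_of_lineAvg hV1 hper hVM (k := k) hm0 hε0 hεsq x₁)
  have hu₂ : 2 + ε * w / 2 ≤ α (-u) := by
    have h1 := le_burningVelocity_of_lineAvg hV1 hper hVM (k := -k)
      (by rw [hneg]; exact neg_ne_zero.2 hm0) hε0 hεsq x₂
    rw [hneg, norm_neg, smul_neg] at h1
    exact (hlarge _ (min_le_right _ _)).trans h1
  have hεw : 0 < ε * w := by positivity
  refine ⟨fun p => existsUnique_isErgodicConstant hεC hεper p, ?_, ?_⟩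
  · rintro ⟨z, r, hS⟩
    have hne : ‖-e‖ = 1 := by rwa [norm_neg]
    have hnu : ‖-u‖ = 1 := by rwa [norm_neg]
    have h1 := burningVelocity_mul_neg_of_eq_sphere hS hen (hpos e hen) (hpos (-e) hne)
    have h2 := burningVelocity_mul_neg_of_eq_sphere hS hun (hpos u hun) (hpos (-u) hnu)
    rw [← hα] at h1 h2
    have h3 : α e * α (-e) < α u * α (-u) := by
      have h4 : α e < α u := by linarith
      have h5 : α (-e) < α (-u) := by linarith
      exact mul_lt_mul'' h4 h5 (hpos e hen).le (hpos (-e) hne).le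
    have h4 : r ^ 2 - ‖z‖ ^ 2 ≠ 0 := right_ne_zero_of_mul (h1.trans_ne one_ne_zero)
    exact h3.ne (mul_right_cancel₀ h4 (h1.trans h2.symm))
  · rintro ⟨b, hb⟩
    have h1 := hb e
    have h2 := hb u
    rw [hen] at h1
    rw [hun] at h2
    linarith
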